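/- **Setting.** Let $\mathbb I=[-1,1]$. Let $(a_j)_{j\in\mathbb N}$ be a bounded real sequence with $\inf_j a_j>-1$. Let $\mu=\bigotimes_j\mu_{a_j,a_j}$ be the symmetric (ultraspherical) infinite product Jacobi probability measure on $\mathbb I^\infty$, where $\mu_{a,b}$ has density $c_{a,b}(1-y)^a(1+y)^b$ on $\mathbb I$. Let $J^{(j)}_k$ be the polynomials of degree $k$ that are orthonormal with respect to $\mu_{a_j,a_j}$ (with positive leading coefficient). For a finitely supported $\nu\in\mathbb N_0^{\mathbb N}$ put $J_\nu(y)=\prod_j J^{(j)}_{\nu_j}(y_j)$ and $p_\nu(\theta,\lambda)=\prod_j(1+\lambda\nu_j)^\theta$. Let $\mathcal F_{ev}$ be the set of finitely supported $\nu$ with all $\nu_j$ even, ordered coordinatewise. Put $\theta_0=\max\{\sup_ja_j,-\frac12\}+\frac12$. Fix $\varepsilon>0$ and a constant $C_\varepsilon>0$ such that $2\|J^{(j)}_k\|_{C(\mathbb I)}\log(2k+3)\le(C_\varepsilon k+1)^{\theta_0+\varepsilon}$ for all $j$ and all $k\ge1$. Put $\theta=\theta_0+1+\varepsilon$ and $\lambda=C_\varepsilon+1$.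 **Assumptions.** Let $X^2\subset X^1$ be Hilbert spaces (both real or both complex) with continuous embedding. Let $V_m\subset X^1$ ($m\in\mathbb N_0$) be subspaces with $\dim V_m\le m$, let $P_m:X^1\to V_m$ be linear operators, and let $\alpha>0$ and $C_1,C_2>0$ be such that for all $w\in X^2$ we have $\|P_mw\|_{X^1}\le C_1\|w\|_{X^1}$ for $m\ge0$, and $\|w-P_mw\|_{X^1}\le C_2m^{-\alpha}\|w\|_{X^2}$ for $m\ge1$. Let $v\in L_2(\mathbb I^\infty,X^2;\mu)$ be represented by an even Jacobi series $$v=\sum_{\nu\in\mathcal F_{ev}}v_\nu J_\nu,\qquad v_\nu=\int vJ_\nu\,d\mu,$$ with convergence in $L_2(\mathbb I^\infty,X^2;\mu)$. Let $0<q_1\le q_2<2$. For $i=1,2$ let $(\sigma_{i;\nu})_{\nu\in\mathcal F_{ev}}\subset(1,\infty)$ be families with $$\sum_{\nu\in\mathcal F_{ev}}\big(\sigma_{i;\nu}\|v_\nu\|_{X^i}\big)^2<\infty,\qquad \big(p_\nu(\theta,\lambda)^{2/q_i}\sigma_{i;\nu}^{-1}\big)_{\nu}\in\ell_{q_i}(\mathcal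 F_{ev}).$$ Let $\sigma_2$ be increasing ($\nu'\le\nu$ implies $\sigma_{2;\nu'}\le\sigma_{2;\nu}$) and, if $\alpha>1/q_2-1/2$, let $\sigma_1$ be increasing too. **Quadrature.** Put $\tau=\frac{2\alpha}{2-q_2}$, $\eta=(\frac1{q_1}-\frac12)^{-1}$, $\vartheta=\frac2{2-q_2}(\frac1{q_1}-\frac12)$. For $\xi>1$ let $G_{ev}(\xi)\subset\mathbb N_0\times\mathcal F_{ev}$ be the set of $(k,\nu)$ with $2^k\sigma_{2;\nu}^{q_2}\le\xi$ if $\alpha\le1/q_2-1/2$, and with $\sigma_{1;\nu}^{q_1}\le\xi(\log\xi)^\eta$ and $2^{\tau k}\sigma_{2;\nu}\le\xi^\vartheta$ if $\alpha>1/q_2-1/2$. Let $\mathcal V(G)=\{\sum_{(k,\nu)\in G}v_kJ_\nu: v_k\in V_{2^k}\}$. Put $\delta_0=P_1$ and $\delta_k=P_{2^k}-P_{2^{k-1}}$ for $k\ge1$. In the $j$-th coordinate, for $m\in\mathbb N_0$ let $Q_m$ be the interpolatory quadrature for $\mu_{a_j,a_j}$ at the $m+1$ Chebyshev nodes $-\cos\frac{(2k+1)\pi}{2(m+1)}$,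 $0\le k\le m$. Put $Q_{-2}=0$ and $\Delta_\nu=\bigotimes_j(Q_{\nu_j}-Q_{\nu_j-2})$ for $\nu\in\mathcal F_{ev}$. For continuous $w:\mathbb I^\infty\to X^2$ and finite $G$ put $\mathcal Q_Gw=\sum_{(k,\nu)\in G}\delta_k\big(\Delta_\nu(w)\big)\in X^1$. **Theorem.** The function $v$ agrees $\mu$-almost everywhere with a continuous function $\mathbb I^\infty\to X^2$, with which it is identified in $\mathcal Q_Gv$. There is a constant $C>0$ (depending on $v$ and the data above, but not on $n$ or $\phi$) such that the following holds for every integer $n\ge1$, respectively $n\ge2$ if $\alpha>1/q_2-1/2$. Put $$R_n=\begin{cases}n^{-\alpha}&\text{if }\alpha\le1/q_2-1/2,\\ n^{-\beta}(\log n)^\kappa&\text{if }\alpha>1/q_2-1/2,\end{cases}$$ $$\beta=\Big(\frac1{q_1}-\frac12\Big)\frac{\alpha}{\alpha+\delta},\qquad \delta=\frac1{q_1}-\frac1{q_2},\qquad \kappa=\frac{\alpha+1/2-1/q_2}{\alpha+1/q_1-1/q_2}.$$ (i) There is $\xi_n>1$ such that $G_{ev}(\xi_n)$ is finite, $\dim\mathcal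 V(G_{ev}(\xi_n))\le n$ and $$\Big\|\int v\,d\mu-\mathcal Q_{G_{ev}(\xi_n)}v\Big\|_{X^1}\le C\,R_n.$$ (ii) For every $\phi\in(X^1)'$ there is $\xi_n>1$ such that $G_{ev}(\xi_n)$ is finite, $\dim\mathcal V(G_{ev}(\xi_n))\le n$ and $$\Big|\int\langle\phi,v\rangle\,d\mu-\langle\phi,\mathcal Q_{G_{ev}(\xi_n)}v\rangle\Big|\le C\,\|\phi\|_{(X^1)'}\,R_n.$$ -/

import Mathlib

open MeasureTheory Filter Topology

noncomputable section

namespace JacobiQuadrature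

/-! ### Univariate Jacobi measures and Jacobi polynomials -/

/-- The interval `[-1, 1]`. -/
abbrev UI : Type := Set.Icc (-1 : ℝ) 1

/-- The normalizing constant `c_{a,b}` of the Jacobi weight. -/
def jacobiConst (a b : ℝ) : ℝ :=
  Real.Gamma (a + b + 2) /
    ((2 : ℝ) ^ (a + b + 1) * Real.Gamma (a + 1) * Real.Gamma (b + 1))

/-- The Jacobi probability measure on `[-1, 1]`, with density `c_{a,b} (1 - y)^a (1 + y)^b`. -/
def jacobiMeasure (a b : ℝ) : Measure UI :=
  (Measure.comap ((↑) : UI → ℝ) volume).withDensity fun y =>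
    ENNReal.ofReal (jacobiConst a b * (1 - (y : ℝ)) ^ a * (1 + (y : ℝ)) ^ b)

/-- For `a, b > -1` the Jacobi measure is a probability measure. -/
theorem isProbabilityMeasure_jacobiMeasure {a b : ℝ} (ha : -1 < a) (hb : -1 < b) :
    IsProbabilityMeasure (jacobiMeasure a b) := by
  refine ⟨?_⟩
  rw [jacobiMeasure, withDensity_apply _ MeasurableSet.univ, Measure.restrict_univ]
  have h1 : ∫⁻ y : UI,
        ENNReal.ofReal (jacobiConst a b * (1 - (y : ℝ)) ^ a * (1 + (y : ℝ)) ^ b)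
          ∂(Measure.comap ((↑) : UI → ℝ) volume) =
      ∫⁻ y in Set.Icc (-1 : ℝ) 1,
        ENNReal.ofReal (jacobiConst a b * (1 - y) ^ a * (1 + y) ^ b) :=
    lintegral_subtype_comap measurableSet_Icc
      (fun y : ℝ => ENNReal.ofReal (jacobiConst a b * (1 - y) ^ a * (1 + y) ^ b))
  have himg : (fun x : ℝ => 2 * x - 1) '' Set.Ioo 0 1 = Set.Ioo (-1 : ℝ) 1 := by
    ext y
    constructor
    · rintro ⟨x, ⟨hx0, hx1⟩, rfl⟩
      constructor <;> simp only <;> linarith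
    · rintro ⟨hy0, hy1⟩
      exact ⟨(y + 1) / 2, ⟨by linarith, by linarith⟩, by simp only; ring⟩
  have hder : ∀ x ∈ Set.Ioo (0 : ℝ) 1,
      HasDerivWithinAt (fun x : ℝ => 2 * x - 1) 2 (Set.Ioo 0 1) x := by
    intro x _
    have := ((hasDerivAt_id x).const_mul (2 : ℝ)).sub_const 1
    simpa using this.hasDerivWithinAt
  have hinj : Set.InjOn (fun x : ℝ => 2 * x - 1) (Set.Ioo 0 1) := by
    intro x _ y _ hxy
    simp only at hxy
    linarith
  rw [h1, ← restrict_Ioo_eq_restrict_Icc, ← himg,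
    lintegral_image_eq_lintegral_abs_deriv_mul measurableSet_Ioo hder hinj,
    ← ProbabilityTheory.lintegral_betaPDF_eq_one (α := b + 1) (β := a + 1)
      (by linarith) (by linarith), ProbabilityTheory.lintegral_betaPDF]
  refine setLIntegral_congr_fun measurableSet_Ioo ?_
  intro x hx
  obtain ⟨hx0, hx1⟩ := hx
  simp only
  rw [← ENNReal.ofReal_mul (abs_nonneg _)]
  congr 1
  have e1 : 1 - (2 * x - 1) = 2 * (1 - x) := by ring
  have e2 : 1 + (2 * x - 1) = 2 * x := by ring
  rw [e1, e2, Real.mul_rpow (by norm_num) (by linarith), Real.mul_rpow (by norm_num) hx0.le,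
    ProbabilityTheory.beta, jacobiConst, Real.rpow_add (by norm_num),
    Real.rpow_add (by norm_num), Real.rpow_one]
  have g1 : Real.Gamma (a + 1) ≠ 0 := (Real.Gamma_pos_of_pos (by linarith)).ne'
  have g2 : Real.Gamma (b + 1) ≠ 0 := (Real.Gamma_pos_of_pos (by linarith)).ne'
  have g3 : Real.Gamma (a + b + 2) ≠ 0 := (Real.Gamma_pos_of_pos (by linarith)).ne'
  have e3 : b + 1 + (a + 1) = a + b + 2 := by ring
  have e4 : b + 1 - 1 = b := by ring
  have e5 : a + 1 - 1 = a := by ring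
  have p1 : (2 : ℝ) ^ a ≠ 0 := (Real.rpow_pos_of_pos (by norm_num) _).ne'
  have p2 : (2 : ℝ) ^ b ≠ 0 := (Real.rpow_pos_of_pos (by norm_num) _).ne'
  rw [e3, e4, e5, abs_of_pos (by norm_num : (0 : ℝ) < 2)]
  field_simp

/-- The monic orthogonal polynomials of the Jacobi measure (Gram-Schmidt on `1, X, X², …`). -/
def monicJacobi (a b : ℝ) (k : ℕ) : Polynomial ℝ :=
  Polynomial.X ^ k - ∑ i : Fin k,
    Polynomial.C ((∫ y : UI, (y : ℝ) ^ k * (monicJacobi a b i).eval (y : ℝ) ∂jacobiMeasure a b) /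
      (∫ y : UI, (monicJacobi a b i).eval (y : ℝ) ^ 2 ∂jacobiMeasure a b)) * monicJacobi a b i
termination_by k
decreasing_by all_goals exact i.isLt

/-- The Jacobi polynomial `J_k`: the polynomial of degree `k`, with positive leading coefficient,
that is orthogonal to all polynomials of smaller degree and normalized in `L²` with respect to
the Jacobi probability measure. -/
def jacobiPoly (a b : ℝ) (k : ℕ) : Polynomial ℝ :=
  Polynomial.C (Real.sqrt (∫ y : UI, (monicJacobi a b k).eval (y : ℝ) ^ 2 ∂jacobiMeasure a b))⁻¹ *
    monicJacobi a b k

/-! ### The product measure and the Jacobi chaos -/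

/-- The parameter domain `[-1, 1]^∞` with its product topology. -/
abbrev UIInf : Type := ℕ → UI

/-- The infinite product of the Jacobi measures with parameters `a j, b j`. -/
def prodJacobi (a b : ℕ → ℝ) : Measure UIInf :=
  Measure.infinitePi fun j => jacobiMeasure (a j) (b j)

/-- Finitely supported multi-indices, with the coordinatewise order. -/
abbrev Idx : Type := ℕ →₀ ℕ

/-- The multi-indices all of whose entries are even. -/
def evenIdx : Set Idx := {ν | ∀ j, Even (ν j)}

/-- The tensor product Jacobi polynomial `J_ν` (the factors with `ν j = 0` are equal to one). -/
def jacobiTensor (a b : ℕ → ℝ) (ν : Idx) (y : UIInf) : ℝ :=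
  ∏ j ∈ ν.support, (jacobiPoly (a j) (b j) (ν j)).eval (y j : ℝ)

/-- The GPC coefficient `v_ν = ∫ v J_ν dμ`. -/
def gpcCoeff {X : Type*} [NormedAddCommGroup X] [NormedSpace ℝ X] (a b : ℕ → ℝ)
    (v : UIInf → X) (ν : Idx) : X :=
  ∫ y, jacobiTensor a b ν y • v y ∂prodJacobi a b

/-- `v` is represented by its even Jacobi GPC series, with (unconditional) convergence in the
Bochner space `L²(μ; X)`. -/
def HasEvenGPC {X : Type*} [NormedAddCommGroup X] [NormedSpace ℝ X] (a b : ℕ → ℝ)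
    (v : UIInf → X) : Prop :=
  MemLp v 2 (prodJacobi a b) ∧
    Tendsto (fun S : Finset evenIdx =>
      eLpNorm (fun y => v y - ∑ ν ∈ S, jacobiTensor a b ν y • gpcCoeff a b v ν) 2
        (prodJacobi a b)) atTop (𝓝 0)

/-- The weights `p_ν(θ, λ) = ∏_j (1 + λ ν_j)^θ`. -/
def pWeight (θ lam : ℝ) (ν : Idx) : ℝ := ∏ j ∈ ν.support, (1 + lam * (ν j : ℝ)) ^ θ

/-- `θ₀ = max {sup_j a_j, sup_j b_j, -1/2} + 1/2`. -/
def thetaZero (a b : ℕ → ℝ) : ℝ := max (max (⨆ j, a j) (⨆ j, b j)) (-1 / 2) + 1 / 2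

/-- `c` is an admissible constant `C_ε`: the sup norms on `[-1, 1]` of the univariate Jacobi
polynomials satisfy `2 ‖J_k‖ log (2k + 3) ≤ (c k + 1)^(θ₀ + ε)` for `k ≥ 1`, in all coordinates. -/
def IsGrowthConst (a b : ℕ → ℝ) (ε c : ℝ) : Prop :=
  0 < c ∧ ∀ (j k : ℕ), 1 ≤ k → ∀ y : UI,
    2 * |(jacobiPoly (a j) (b j) k).eval (y : ℝ)| * Real.log (2 * (k : ℝ) + 3) ≤
      (c * (k : ℝ) + 1) ^ (thetaZero a b + ε)

/-! ### Chebyshev nodes and univariate quadrature -/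

/-- The Chebyshev nodes `y_{m,k} = - cos ((2k+1)π / (2(m+1)))`. -/
def chebNode (m k : ℕ) : UI :=
  ⟨-Real.cos ((2 * (k : ℝ) + 1) * Real.pi / (2 * ((m : ℝ) + 1))),
    ⟨neg_le_neg (Real.cos_le_one _), neg_le.mp (Real.neg_one_le_cos _)⟩⟩

/-- The Lagrange polynomial `L_{m,k}` of the nodes `y_{m,0}, …, y_{m,m}`. -/
def lagrangePoly (m k : ℕ) (y : UI) : ℝ :=
  ∏ j ∈ (Finset.range (m + 1)).erase k,
    ((y : ℝ) - chebNode m j) / ((chebNode m k : ℝ) - chebNode m j)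

/-- The quadrature weights `ω_{m,k} = ∫ L_{m,k} dμ_{a,b}`. -/
def quadWeight (a b : ℝ) (m k : ℕ) : ℝ := ∫ y, lagrangePoly m k y ∂jacobiMeasure a b

section Operators

variable {X : Type*} [AddCommGroup X] [Module ℝ X]

/-- The univariate interpolatory quadrature `Q_m`. -/
def quad (a b : ℝ) (m : ℕ) (f : UI → X) : X :=
  ∑ k ∈ Finset.range (m + 1), quadWeight a b m k • f (chebNode m k)

/-- The increment `Q_m - Q_{m-2}` (for even `m`), with the convention `Q_{-2} = 0`. -/
def quadIncr (a b : ℝ) (m : ℕ) (f : UI → X) : X :=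
  quad a b m f - if m < 2 then 0 else quad a b (m - 2) f

/-- Apply successively, for `j < N`, the univariate increment of order `ν j` in the variable
`y j`, the other variables being held fixed. -/
def quadIncrUpTo (a b : ℕ → ℝ) (ν : Idx) : ℕ → (UIInf → X) → UIInf → X
  | 0, v => v
  | N + 1, v => fun y =>
      quadIncr (a N) (b N) (ν N) fun t => quadIncrUpTo a b ν N v (Function.update y N t)

/-- The tensorized increment `Δ_ν = ⨂_j (Q_{ν j} - Q_{ν j - 2})`. All coordinates up to the last
one in the support of `ν` are treated by `quadIncrUpTo`. In each remaining coordinate the factor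
is `Q_0`, the evaluation at the single node `y_{0,0}`. -/
def tensorQuadIncr (a b : ℕ → ℝ) (ν : Idx) (v : UIInf → X) : X :=
  quadIncrUpTo a b ν (ν.support.sup Nat.succ) v fun _ => chebNode 0 0

end Operators

/-! ### Index sets, spatial discretization, the fully discrete quadrature -/

/-- The thresholded even index sets `G_ev(ξ)`. -/
def indexSet (α q₁ q₂ : ℝ) (σ₁ σ₂ : Idx → ℝ) (ξ : ℝ) : Set (ℕ × Idx) :=
  {p | p.2 ∈ evenIdx ∧
    if α ≤ 1 / q₂ - 1 / 2 then
      (2 : ℝ) ^ p.1 * σ₂ p.2 ^ q₂ ≤ ξ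
    else
      σ₁ p.2 ^ q₁ ≤ ξ * Real.log ξ ^ (1 / q₁ - 1 / 2)⁻¹ ∧
      (2 : ℝ) ^ (2 * α / (2 - q₂) * (p.1 : ℝ)) * σ₂ p.2 ≤
        ξ ^ (2 / (2 - q₂) * (1 / q₁ - 1 / 2))}

/-- The convergence rate: `n^(-α)`, respectively `n^(-β) (log n)^κ`. -/
def rate (α q₁ q₂ : ℝ) (n : ℕ) : ℝ :=
  if α ≤ 1 / q₂ - 1 / 2 then
    (n : ℝ) ^ (-α)
  else
    (n : ℝ) ^ (-((1 / q₁ - 1 / 2) * (α / (α + (1 / q₁ - 1 / q₂))))) *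
      Real.log n ^ ((α + 1 / 2 - 1 / q₂) / (α + 1 / q₁ - 1 / q₂))

section Spaces

variable {𝕜 : Type*} [RCLike 𝕜]
  {X₁ : Type*} [NormedAddCommGroup X₁] [InnerProductSpace 𝕜 X₁]
  {X₂ : Type*} [NormedAddCommGroup X₂] [InnerProductSpace 𝕜 X₂]

/-- Stable and consistent spatial approximation of rate `α`: subspaces `V m` of `X₁` of dimension
at most `m` and linear operators `P m` from `X₁` into `V m`. The embedding of `X₂` into `X₁`
is `ι`. -/
structure IsSpatialApprox (ι : X₂ →L[𝕜] X₁) (V : ℕ → Submodule 𝕜 X₁) (P : ℕ → X₁ →ₗ[𝕜] X₁)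
    (α : ℝ) : Prop where
  alpha_pos : 0 < α
  zero_space : V 0 = ⊥
  rank_le : ∀ m, Module.rank 𝕜 (V m) ≤ (m : Cardinal)
  mem : ∀ m w, P m w ∈ V m
  stable : ∃ C₁ > 0, ∀ (m : ℕ) (w : X₂), ‖P m (ι w)‖ ≤ C₁ * ‖ι w‖
  consistent : ∃ C₂ > 0, ∀ m : ℕ, 1 ≤ m → ∀ w : X₂,
    ‖ι w - P m (ι w)‖ ≤ C₂ * (m : ℝ) ^ (-α) * ‖w‖

/-- The increments `δ_0 = P_1` and `δ_k = P_{2^k} - P_{2^(k-1)}`. -/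
def spatialIncr (P : ℕ → X₁ →ₗ[𝕜] X₁) : ℕ → X₁ → X₁
  | 0, w => P 1 w
  | k + 1, w => P (2 ^ (k + 1)) w - P (2 ^ k) w

/-- The space spanned by the functions `y ↦ J_ν(y) w` with `(k, ν) ∈ G` and `w ∈ V (2^k)`. -/
def approxSpace [NormedSpace ℝ X₁] (a b : ℕ → ℝ) (V : ℕ → Submodule 𝕜 X₁)
    (G : Set (ℕ × Idx)) : Submodule 𝕜 (UIInf → X₁) :=
  Submodule.span 𝕜 {f | ∃ p ∈ G, ∃ w ∈ V (2 ^ p.1), f = fun y => jacobiTensor a b p.2 y • w}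

/-- The fully discrete Smolyak quadrature `∑_{(k, ν) ∈ G} (δ_k ⊗ Δ_ν) v` (for finite `G`). -/
def smolyakQuad [NormedSpace ℝ X₂] (a b : ℕ → ℝ) (ι : X₂ →L[𝕜] X₁) (P : ℕ → X₁ →ₗ[𝕜] X₁)
    (G : Set (ℕ × Idx)) (v : UIInf → X₂) : X₁ :=
  ∑ᶠ p ∈ G, spatialIncr P p.1 (ι (tensorQuadIncr a b p.2 v))

end Spaces

/-- Weighted summability over the even multi-indices of a family of norms `c ν = ‖v_ν‖`, with
weights `σ ν > 1` and exponent `q`:  `∑ (σ_ν c_ν)² < ∞` and `(p_ν^(2/q) σ_ν⁻¹) ∈ ℓ_q`. -/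
structure IsWeightedSummable (θ lam q : ℝ) (σ c : Idx → ℝ) : Prop where
  one_lt : ∀ ν ∈ evenIdx, 1 < σ ν
  summable_sq : Summable fun ν : evenIdx => (σ ν * c ν) ^ 2
  summable_weight : Summable fun ν : evenIdx => (pWeight θ lam ν ^ (2 / q) * (σ ν)⁻¹) ^ q

end JacobiQuadrature

end

open JacobiQuadrature

noncomputable section

namespace JacobiQuadrature

/-! ### The Lebesgue constant of the Chebyshev nodes -/

/-! By exactness of the interpolatory rules, `Δ_{ν'} J_ν` vanishes unless `ν' ≤ ν`, and the sum of
`Δ_{ν'} J_ν` over even `ν' ≤ ν` telescopes to `∫ J_ν dμ`, which is `1` for `ν = 0` and `0`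
otherwise. Each fibre of `G` over `ν` is an initial segment `{k < M ν}`, on which `∑ δ_k` telescopes
to a single spatial operator, `P_{2^(M ν - 1)}`, or `0` if `M ν = 0`. Inserting the Jacobi series of
`v` gives the error representation `hasSum_error`: `∫ v - Q_G v = ∑_ν ∑_{ν' ≤ ν} (Δ_{ν'} J_ν) (v_ν -
∑_{k < M ν'} δ_k v_ν)`.

The weights `p_ν` absorb the inner sum: `∑_{ν' ≤ ν} |Δ_{ν'} J_ν| ≤ p_ν` (`sum_abs_tensorIncr_le`).
This reduces to one variable, where the growth assumption on the Jacobi polynomials is met by the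
Lebesgue constant `≤ 2 log (2m + 3)` of the Chebyshev nodes. That constant is obtained by writing
the Lagrange polynomials as sums of two Dirichlet kernels.

It remains to bound the spatial remainder by a quantity depending on `ν` only. The first level `M
ν'` outside `G` violates a threshold inequality, which makes `2^(-α M ν')` small compared with a
power of `σ_{ν'}`; monotonicity of the weights replaces `ν'` by `ν`. The resulting series are
controlled by `∑ p_ν σ_ν^(1 - q/2) ‖v_ν‖`, which is finite by `IsWeightedSummable.summable_mul`. The
same bound yields absolute convergence of the Jacobi series in the sup norm, hence the continuous
representative.

The dimension is at most `∑_{(k,ν) ∈ G} 2^k`, a sum of geometric series over the fibres, and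
summability of `σ_ν^(-q)` bounds it by a power of `ξ`, with a logarithmic factor if `α > 1/q₂ -
1/2`. Solving for `ξ` in terms of `n` gives the rate for large `n`. For the remaining finitely many
`n`, an empty index set is admissible and the constant is enlarged. The bound for functionals uses
the same `ξ`, since `|φ x| ≤ ‖φ‖ ‖x‖`. -/

/-- The Dirichlet kernel `1/2 + ∑_{1 ≤ j ≤ m} cos (j t)`. -/
def dirKernel (m : ℕ) (t : ℝ) : ℝ := 1 / 2 + ∑ j ∈ Finset.range m, Real.cos (((j : ℝ) + 1) * t)

theorem dirKernel_neg (m : ℕ) (t : ℝ) : dirKernel m (-t) = dirKernel m t := by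
  simp [dirKernel]

theorem dirKernel_add_two_pi (m : ℕ) (t : ℝ) :
    dirKernel m (t + 2 * Real.pi) = dirKernel m t := by
  simp only [dirKernel]
  congr 1
  refine Finset.sum_congr rfl fun j _ => ?_
  have : ((j : ℝ) + 1) * (t + 2 * Real.pi) = ((j : ℝ) + 1) * t + (j + 1 : ℕ) * (2 * Real.pi) := by
    push_cast; ring
  rw [this, Real.cos_add_nat_mul_two_pi]

theorem two_sin_mul_dirKernel (m : ℕ) (t : ℝ) :
    2 * Real.sin (t / 2) * dirKernel m t = Real.sin (((m : ℝ) + 1 / 2) * t) := by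
  induction m with
  | zero => simp [dirKernel]; ring_nf
  | succ m ih =>
    have h : dirKernel (m + 1) t = dirKernel m t + Real.cos (((m : ℝ) + 1) * t) := by
      simp [dirKernel, Finset.sum_range_succ, add_assoc]
    rw [h, mul_add, ih]
    have e1 : ((m : ℝ) + 1 / 2) * t = ((m : ℝ) + 1) * t - t / 2 := by ring
    have e2 : (((m + 1 : ℕ) : ℝ) + 1 / 2) * t = ((m : ℝ) + 1) * t + t / 2 := by push_cast; ring
    rw [e1, e2, Real.sin_add, Real.sin_sub]
    ring

theorem abs_dirKernel_le (m : ℕ) (t : ℝ) : |dirKernel m t| ≤ m + 1 := by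
  have h : |∑ j ∈ Finset.range m, Real.cos (((j : ℝ) + 1) * t)| ≤ m := by
    refine (Finset.abs_sum_le_sum_abs _ _).trans ?_
    refine (Finset.sum_le_sum fun j _ => Real.abs_cos_le_one _).trans ?_
    simp
  have := abs_add_le (1 / 2) (∑ j ∈ Finset.range m, Real.cos (((j : ℝ) + 1) * t))
  rw [abs_of_pos (by norm_num : (0 : ℝ) < 1 / 2)] at this
  unfold dirKernel
  linarith

/-- Jordan's inequality `sin (t/2) ≥ t/π` on `[0, π]`, applied to the closed form `2 sin (t/2) D(t)
= sin ((m + 1/2) t)`. This decay is the source of the logarithm in the Lebesgue constant. -/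
theorem abs_dirKernel_mul_le (m : ℕ) {t : ℝ} (ht : |t| ≤ Real.pi) :
    |dirKernel m t| * |t| ≤ Real.pi / 2 := by
  have h0 : ∀ t : ℝ, 0 ≤ t → t ≤ Real.pi → |dirKernel m t| * t ≤ Real.pi / 2 := by
    intro t h0 h1
    have h2 := Real.mul_le_sin (x := t / 2) (by linarith) (by linarith)
    have h3 := two_sin_mul_dirKernel m t
    have h4 : |2 * Real.sin (t / 2) * dirKernel m t| ≤ 1 := by
      rw [h3]; exact Real.abs_sin_le_one _
    have hpi := Real.pi_pos
    have h5 : 0 ≤ 2 / Real.pi * (t / 2) := by positivity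
    rw [abs_mul, abs_of_nonneg (by linarith : 0 ≤ 2 * Real.sin (t / 2))] at h4
    have h6 : 2 * (2 / Real.pi * (t / 2)) * |dirKernel m t| ≤ 1 :=
      (mul_le_mul_of_nonneg_right (by linarith) (abs_nonneg _)).trans h4
    have h7 : 2 * (2 / Real.pi * (t / 2)) * |dirKernel m t| =
        (|dirKernel m t| * t) * (2 / Real.pi) := by ring
    rw [h7, ← le_div_iff₀ (by positivity)] at h6
    refine h6.trans (le_of_eq ?_)
    rw [one_div_div]
  rcases le_total 0 t with h | h
  · rw [abs_of_nonneg h] at ht ⊢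
    exact h0 t h ht
  · rw [abs_of_nonpos h] at ht ⊢
    rw [← dirKernel_neg]
    exact h0 (-t) (by linarith) ht

/-- At these points `(m + 1/2) t = l π - t/2`, so the closed form loses its sine factors and only
the parity of `l` survives. -/
theorem dirKernel_int_mul_pi_div (m : ℕ) (l : ℤ)
    (h : Real.sin ((l : ℝ) * Real.pi / ((m : ℝ) + 1) / 2) ≠ 0) :
    dirKernel m ((l : ℝ) * Real.pi / ((m : ℝ) + 1)) = -((-1) ^ l) / 2 := by
  set t := (l : ℝ) * Real.pi / ((m : ℝ) + 1) with ht
  have hm : (m : ℝ) + 1 ≠ 0 := by positivity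
  have h1 := two_sin_mul_dirKernel m t
  have h2 : ((m : ℝ) + 1 / 2) * t = l * Real.pi - t / 2 := by
    rw [ht]; field_simp; ring
  rw [h2, Real.sin_int_mul_pi_sub] at h1
  have : 2 * Real.sin (t / 2) * (dirKernel m t - -((-1) ^ l) / 2) = 0 := by
    rw [mul_sub, h1]; ring
  rcases mul_eq_zero.mp this with h3 | h3
  · exact absurd h3 (by simpa using h)
  · linarith

/-- The angle `(2 k + 1) π / (2 (m + 1))` of the `k`-th Chebyshev node. -/
def chebAngle (m : ℕ) (k : ℤ) : ℝ := (2 * (k : ℝ) + 1) * Real.pi / (2 * ((m : ℝ) + 1))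

theorem chebNode_eq (m k : ℕ) : (chebNode m k : ℝ) = -Real.cos (chebAngle m k) := by
  simp [chebNode, chebAngle]

theorem chebAngle_mem {m k : ℕ} (hk : k ≤ m) :
    chebAngle m k ∈ Set.Icc 0 Real.pi := by
  have hpi := Real.pi_pos
  have hk' : (k : ℝ) ≤ m := by exact_mod_cast hk
  unfold chebAngle
  constructor
  · positivity
  · rw [div_le_iff₀ (by positivity)]
    push_cast
    nlinarith

theorem chebNode_injOn (m : ℕ) :
    Set.InjOn (fun k => (chebNode m k : ℝ)) (Finset.range (m + 1)) := by
  intro i hi j hj hij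
  simp only [Finset.coe_range, Set.mem_Iio] at hi hj
  simp only [chebNode_eq, neg_inj] at hij
  have h := Real.injOn_cos (chebAngle_mem (Nat.lt_succ_iff.mp hi))
    (chebAngle_mem (Nat.lt_succ_iff.mp hj)) hij
  have hpi := Real.pi_pos
  unfold chebAngle at h
  have hm : (0 : ℝ) < 2 * ((m : ℝ) + 1) := by positivity
  rw [div_left_inj' hm.ne', mul_left_inj' hpi.ne'] at h
  push_cast at h
  have : (i : ℝ) = j := by linarith
  exact_mod_cast this

/-- The Lagrange polynomial of the Chebyshev nodes, as an element of `ℝ[X]`. -/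
abbrev lagrangeBasis (m k : ℕ) : Polynomial ℝ :=
  Lagrange.basis (Finset.range (m + 1)) (fun k => (chebNode m k : ℝ)) k

theorem eval_lagrangeBasis (m k : ℕ) (y : UI) :
    (lagrangeBasis m k).eval (y : ℝ) = lagrangePoly m k y := by
  simp only [lagrangeBasis, Lagrange.basis, lagrangePoly, Polynomial.eval_prod,
    Lagrange.basisDivisor, Polynomial.eval_mul, Polynomial.eval_C, Polynomial.eval_sub,
    Polynomial.eval_X]
  refine Finset.prod_congr rfl fun j _ => ?_
  rw [div_eq_inv_mul]

/-- The expansion of the Lagrange polynomials of the Chebyshev nodes in Chebyshev polynomials. -/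
def chebLagrange (m k : ℕ) : Polynomial ℝ :=
  Polynomial.C ((m : ℝ) + 1)⁻¹ * (1 + ∑ j ∈ Finset.range m,
    Polynomial.C (2 * Real.cos (((j : ℝ) + 1) * (Real.pi - chebAngle m k))) *
      Polynomial.Chebyshev.T ℝ ((j : ℤ) + 1))

/-- Since `-cos s = cos (π - s)`, this is `2 cos (j u) cos (j v) = cos (j (u - v)) + cos (j (u +
v))` summed over `j`. -/
theorem eval_chebLagrange (m k : ℕ) (s : ℝ) :
    (chebLagrange m k).eval (-Real.cos s) =
      ((m : ℝ) + 1)⁻¹ * (dirKernel m (s - chebAngle m k) + dirKernel m (s + chebAngle m k)) := by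
  have h1 : dirKernel m (s - chebAngle m k) =
      dirKernel m ((Real.pi - s) - (Real.pi - chebAngle m k)) := by
    rw [← dirKernel_neg]; congr 1; ring
  have h2 : dirKernel m (s + chebAngle m k) =
      dirKernel m ((Real.pi - s) + (Real.pi - chebAngle m k)) := by
    rw [← dirKernel_neg, ← dirKernel_add_two_pi]; congr 1; ring
  rw [h1, h2, ← Real.cos_pi_sub]
  simp only [chebLagrange, Polynomial.eval_mul, Polynomial.eval_C, Polynomial.eval_add,
    Polynomial.eval_one, Polynomial.eval_finsetSum, Polynomial.Chebyshev.T_real_cos, dirKernel]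
  congr 1
  rw [add_add_add_comm, ← Finset.sum_add_distrib]
  congr 1
  · norm_num
  · refine Finset.sum_congr rfl fun j _ => ?_
    rw [mul_sub _ (Real.pi - s), mul_add _ (Real.pi - s), Real.cos_sub, Real.cos_add]
    push_cast
    ring

theorem degree_chebLagrange_lt (m k : ℕ) :
    (chebLagrange m k).degree < (Finset.range (m + 1)).card := by
  rw [Finset.card_range]
  have h : (chebLagrange m k).degree ≤ (m : ℕ) := by
    unfold chebLagrange
    rw [← Polynomial.smul_eq_C_mul]
    refine (Polynomial.degree_smul_le _ _).trans ?_
    refine (Polynomial.degree_add_le _ _).trans (max_le ?_ ?_)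
    · exact Polynomial.degree_one_le.trans (by exact_mod_cast Nat.zero_le m)
    · refine (Polynomial.degree_sum_le _ _).trans (Finset.sup_le fun j hj => ?_)
      rw [← Polynomial.smul_eq_C_mul]
      refine (Polynomial.degree_smul_le _ _).trans ?_
      rw [Polynomial.Chebyshev.degree_T]
      have := Finset.mem_range.mp hj
      exact_mod_cast (by omega : ((j : ℤ) + 1).natAbs ≤ m)
  exact h.trans_lt (by exact_mod_cast Nat.lt_succ_self m)

theorem sin_half_ne_zero {m : ℕ} {l : ℤ} (h0 : l ≠ 0) (h1 : |l| < 2 * ((m : ℤ) + 1)) :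
    Real.sin ((l : ℝ) * Real.pi / ((m : ℝ) + 1) / 2) ≠ 0 := by
  have hpi := Real.pi_pos
  have hm : (0 : ℝ) < (m : ℝ) + 1 := by positivity
  have h2 : ((l : ℝ) * Real.pi / ((m : ℝ) + 1) / 2) = (l / (2 * ((m : ℝ) + 1))) * Real.pi := by
    field_simp
  have h3 : |(l : ℝ)| < 2 * ((m : ℝ) + 1) := by exact_mod_cast h1
  rw [abs_lt] at h3
  have h4 : -Real.pi < (l / (2 * ((m : ℝ) + 1))) * Real.pi := by
    have : -1 < l / (2 * ((m : ℝ) + 1)) := by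
      rw [lt_div_iff₀ (by positivity)]; linarith
    nlinarith
  have h5 : (l / (2 * ((m : ℝ) + 1))) * Real.pi < Real.pi := by
    have : l / (2 * ((m : ℝ) + 1)) < 1 := by
      rw [div_lt_iff₀ (by positivity)]; linarith
    nlinarith
  rw [h2, Ne, Real.sin_eq_zero_iff_of_lt_of_lt h4 h5]
  have : (l : ℝ) ≠ 0 := by exact_mod_cast h0
  positivity

theorem eval_chebLagrange_chebNode {m k i : ℕ} (hk : k ≤ m) (hi : i ≤ m) :
    (chebLagrange m k).eval (chebNode m i : ℝ) = if i = k then 1 else 0 := by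
  rw [chebNode_eq, eval_chebLagrange]
  have hm : (0 : ℝ) < (m : ℝ) + 1 := by positivity
  have e1 : chebAngle m i - chebAngle m k = ((i - k : ℤ) : ℝ) * Real.pi / ((m : ℝ) + 1) := by
    unfold chebAngle; push_cast; field_simp; ring
  have e2 : chebAngle m i + chebAngle m k = ((i + k + 1 : ℤ) : ℝ) * Real.pi / ((m : ℝ) + 1) := by
    unfold chebAngle; push_cast; field_simp; ring
  have h2 := dirKernel_int_mul_pi_div m (i + k + 1)
    (sin_half_ne_zero (by omega) (by rw [abs_of_nonneg (by omega)]; omega))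
  rw [e1, e2, h2]
  split_ifs with hik
  · subst hik
    have h3 : dirKernel m 0 = 1 / 2 + m := by simp [dirKernel]
    have h4 : (-1 : ℝ) ^ ((i : ℤ) + i + 1) = -1 := Odd.neg_one_zpow ⟨i, by ring⟩
    rw [h4]
    simp only [sub_self, Int.cast_zero, zero_mul, zero_div, h3]
    field_simp
    ring
  · have h1 := dirKernel_int_mul_pi_div m (i - k)
      (sin_half_ne_zero (by omega) (by rw [abs_lt]; omega))
    rw [h1]
    -- The integers `i - k` and `i + k + 1` have opposite parity, so the two kernel values cancel.
    have h4 : (-1 : ℝ) ^ ((i : ℤ) + k + 1) = -(-1) ^ ((i : ℤ) - k) := by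
      have : (i : ℤ) + k + 1 = (i - k) + (2 * k + 1) := by ring
      rw [this, zpow_add₀ (by norm_num), Odd.neg_one_zpow (⟨k, rfl⟩ : Odd (2 * (k : ℤ) + 1))]
      ring
    rw [h4]
    ring

theorem lagrangeBasis_eq_chebLagrange {m k : ℕ} (hk : k ≤ m) :
    lagrangeBasis m k = chebLagrange m k := by
  have hmem : k ∈ Finset.range (m + 1) := Finset.mem_range.mpr (Nat.lt_succ_of_le hk)
  refine Polynomial.eq_of_degrees_lt_of_eval_index_eq (Finset.range (m + 1))
    (v := fun k => (chebNode m k : ℝ)) (chebNode_injOn m) ?_ (degree_chebLagrange_lt m k) ?_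
  · rw [Lagrange.degree_basis (chebNode_injOn m) hmem, Finset.card_range]
    exact_mod_cast Nat.lt_succ_self m
  · intro i hi
    rw [eval_chebLagrange_chebNode hk (Nat.lt_succ_iff.mp (Finset.mem_range.mp hi))]
    split_ifs with hik
    · subst hik
      exact Lagrange.eval_basis_self (chebNode_injOn m) hmem
    · exact Lagrange.eval_basis_of_ne (v := fun k => (chebNode m k : ℝ)) (fun h => hik h.symm) hi

/-! ### Summation of the kernel bounds over the nodes. -/

/-- Both sides sum `G` over `2n` consecutive integers, that is, over a full period, arranged in
pairs around the centre. -/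
theorem sum_reflected_eq_of_periodic {G : ℤ → ℝ} {n : ℕ} (hG : ∀ i, G (i + 2 * n) = G i) (c : ℤ) :
    ∑ d ∈ Finset.range n, (G (c - 1 - d) + G (c + d)) =
      ∑ d ∈ Finset.range n, (G (-1 - d) + G d) := by
  have step : ∀ c : ℤ, ∑ d ∈ Finset.range n, (G (c + 1 - 1 - d) + G (c + 1 + d)) =
      ∑ d ∈ Finset.range n, (G (c - 1 - d) + G (c + d)) := by
    intro c
    have h1 := Finset.sum_range_sub' (fun d : ℕ => G (c - d)) n
    have h2 := Finset.sum_range_sub (fun d : ℕ => G (c + d)) n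
    have h3 := hG (c - n)
    rw [show c - n + 2 * (n : ℤ) = c + n by ring] at h3
    rw [← sub_eq_zero, ← Finset.sum_sub_distrib]
    have h4 : ∀ d ∈ Finset.range n, G (c + 1 - 1 - d) + G (c + 1 + d) -
        (G (c - 1 - d) + G (c + d)) =
        (G (c - d) - G (c - (d + 1 : ℕ))) + (G (c + (d + 1 : ℕ)) - G (c + d)) := by
      intro d _
      rw [show c + 1 - 1 - (d : ℤ) = c - d by ring, show c + 1 + (d : ℤ) = c + (d + 1 : ℕ) by
        push_cast; ring, show c - 1 - (d : ℤ) = c - (d + 1 : ℕ) by push_cast; ring]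
      ring
    rw [Finset.sum_congr rfl h4, Finset.sum_add_distrib, h1, h2]
    simp only [Nat.cast_zero, sub_zero, add_zero]
    linarith
  induction c using Int.induction_on with
  | zero => simp
  | succ i ih => rw [step, ih]
  | pred i ih => rw [← ih, ← step, sub_add_cancel]

theorem abs_dirKernel_le_of_le {m d : ℕ} {t : ℝ} (hd : 0 < d)
    (h1 : Real.pi / ((m : ℝ) + 1) * d ≤ |t|) (h2 : |t| ≤ Real.pi) :
    |dirKernel m t| ≤ ((m : ℝ) + 1) * (1 / (2 * d)) := by
  have hpi := Real.pi_pos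
  have hd' : (0 : ℝ) < d := by exact_mod_cast hd
  have h3 := abs_dirKernel_mul_le m h2
  have h4 : |dirKernel m t| * (Real.pi / ((m : ℝ) + 1) * d) ≤ Real.pi / 2 :=
    (mul_le_mul_of_nonneg_left h1 (abs_nonneg _)).trans h3
  rw [← le_div_iff₀ (by positivity)] at h4
  refine h4.trans (le_of_eq ?_)
  field_simp

/-- The Lebesgue constant of the `m + 1` Chebyshev nodes is at most `2 + ∑_{d ≤ m} 1 / d`. -/
theorem sum_abs_lagrangePoly_le (m : ℕ) (y : UI) :
    ∑ k ∈ Finset.range (m + 1), |lagrangePoly m k y| ≤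
      2 + ∑ d ∈ Finset.range m, 1 / ((d : ℝ) + 1) := by
  have hpi := Real.pi_pos
  have hm : (0 : ℝ) < (m : ℝ) + 1 := by positivity
  obtain ⟨s, hs⟩ : ∃ s : ℝ, (y : ℝ) = -Real.cos s :=
    ⟨Real.arccos (-y), by rw [Real.cos_arccos] <;> linarith [y.2.1, y.2.2]⟩
  set G : ℤ → ℝ := fun i => |dirKernel m (s - chebAngle m i)| with hG
  have hper : ∀ i, G (i + 2 * (m + 1 : ℕ)) = G i := by
    intro i
    simp only [hG]
    rw [← dirKernel_add_two_pi m (s - chebAngle m (i + 2 * (m + 1 : ℕ)))]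
    congr 2
    unfold chebAngle
    push_cast
    field_simp
    ring
  have hle : ∑ k ∈ Finset.range (m + 1), |lagrangePoly m k y| ≤
      ((m : ℝ) + 1)⁻¹ * ∑ d ∈ Finset.range (m + 1), (G (-1 - d) + G d) := by
    rw [Finset.mul_sum]
    refine Finset.sum_le_sum fun k hk => ?_
    rw [← eval_lagrangeBasis, lagrangeBasis_eq_chebLagrange
      (Nat.lt_succ_iff.mp (Finset.mem_range.mp hk)), hs, eval_chebLagrange, abs_mul,
      abs_of_pos (inv_pos.mpr hm)]
    refine mul_le_mul_of_nonneg_left ?_ (inv_pos.mpr hm).le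
    -- Reflecting the angle amounts to the index change `k ↦ -1 - k`, so the two kernels together
    -- sample a full period of equispaced angles.
    have : s + chebAngle m k = s - chebAngle m (-1 - k) := by
      unfold chebAngle; push_cast; ring
    rw [this, add_comm (G _)]
    exact abs_add_le _ _
  set x : ℝ := (m + 1) * s / Real.pi - 1 / 2 with hx
  have hangle : ∀ i : ℤ, s - chebAngle m i = Real.pi / ((m : ℝ) + 1) * (x - i) := by
    intro i
    rw [hx]; unfold chebAngle; field_simp; ring
  -- Recentring the window next to the position `x` of `s`, in node spacings: the `d`-th pair then
  -- lies at distance between `d` and `d + 1` from `x`. The pair `d = 0` contributes `2`, the others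
  -- `1/d` each.
  set c : ℤ := ⌊x⌋ + 1 with hc
  have hc1 : (c : ℝ) - 1 ≤ x := by rw [hc]; push_cast; linarith [Int.floor_le x]
  have hc2 : x ≤ c := by rw [hc]; push_cast; exact (Int.lt_floor_add_one x).le
  have hw : 0 < Real.pi / ((m : ℝ) + 1) := by positivity
  have hbd : ∀ i : ℤ, ∀ d : ℕ, d ≤ m → d ≤ |x - i| → |x - i| ≤ d + 1 →
      G i ≤ ((m : ℝ) + 1) * (if d = 0 then 1 else 1 / (2 * (d : ℝ))) := by
    intro i d hdm h1 h2
    split_ifs with hd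
    · simpa using abs_dirKernel_le m _
    · refine abs_dirKernel_le_of_le (Nat.pos_of_ne_zero hd) ?_ ?_
      · rw [hangle, abs_mul, abs_of_pos hw]
        exact mul_le_mul_of_nonneg_left h1 hw.le
      · rw [hangle, abs_mul, abs_of_pos hw, div_mul_eq_mul_div, div_le_iff₀ hm]
        have : (d : ℝ) ≤ m := by exact_mod_cast hdm
        exact mul_le_mul_of_nonneg_left (by linarith) hpi.le
  have hsum : ∑ d ∈ Finset.range (m + 1), (G (-1 - d) + G d) ≤
      ∑ d ∈ Finset.range (m + 1), ((m : ℝ) + 1) * (2 * if d = 0 then 1 else 1 / (2 * (d : ℝ))) := by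
    rw [← sum_reflected_eq_of_periodic hper c]
    refine Finset.sum_le_sum fun d hd => ?_
    have hdm := Nat.lt_succ_iff.mp (Finset.mem_range.mp hd)
    have g1 := hbd (c - 1 - d) d hdm
      (by push_cast; rw [abs_of_nonneg (by linarith [(Nat.cast_nonneg d : (0 : ℝ) ≤ d)])]; linarith)
      (by push_cast; rw [abs_of_nonneg (by linarith [(Nat.cast_nonneg d : (0 : ℝ) ≤ d)])]; linarith)
    have g2 := hbd (c + d) d hdm
      (by push_cast; rw [abs_of_nonpos (by linarith [(Nat.cast_nonneg d : (0 : ℝ) ≤ d)])]; linarith)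
      (by push_cast; rw [abs_of_nonpos (by linarith [(Nat.cast_nonneg d : (0 : ℝ) ≤ d)])]; linarith)
    linarith
  refine hle.trans ((mul_le_mul_of_nonneg_left hsum (inv_pos.mpr hm).le).trans (le_of_eq ?_))
  rw [← Finset.mul_sum, inv_mul_cancel_left₀ hm.ne', Finset.sum_range_succ', add_comm]
  congr 1
  · simp
  · refine Finset.sum_congr rfl fun d _ => ?_
    have : (d : ℝ) + 1 ≠ 0 := by positivity
    simp
    field_simp

theorem two_add_harmonic_le (m : ℕ) :
    2 + ∑ d ∈ Finset.range m, 1 / ((d : ℝ) + 1) ≤ 2 * Real.log (2 * (m : ℝ) + 3) := by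
  rcases Nat.eq_zero_or_pos m with rfl | hm
  · have : 1 ≤ Real.log 3 := by
      rw [Real.le_log_iff_exp_le (by norm_num)]
      linarith [Real.exp_one_lt_d9]
    simp
    linarith
  · have h1 := harmonic_le_one_add_log m
    simp only [harmonic, Rat.cast_sum, Rat.cast_inv] at h1
    push_cast at h1
    have hm' : (0 : ℝ) < m := by exact_mod_cast hm
    have h2 : Real.log m + 3 ≤ Real.log ((2 * (m : ℝ) + 3) ^ 2) := by
      rw [Real.le_log_iff_exp_le (by positivity), Real.exp_add, Real.exp_log hm']
      have h3 : Real.exp 3 ≤ 20.1 := by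
        have : Real.exp 3 = Real.exp 1 ^ 3 := by rw [← Real.exp_nat_mul]; norm_num
        rw [this]
        calc Real.exp 1 ^ 3 ≤ 2.7183 ^ 3 := by
              gcongr; linarith [Real.exp_one_lt_d9]
          _ ≤ 20.1 := by norm_num
      nlinarith [sq_nonneg ((m : ℝ) - 1), mul_le_mul_of_nonneg_left h3 hm'.le]
    rw [Real.log_pow] at h2
    push_cast at h2
    simp only [one_div]
    linarith

/-! ### Univariate Jacobi polynomials and quadrature -/

theorem natDegree_monicJacobi_le (a b : ℝ) (k : ℕ) : (monicJacobi a b k).natDegree ≤ k := by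
  induction k using Nat.strong_induction_on with
  | _ k ih =>
    rw [monicJacobi]
    refine (Polynomial.natDegree_sub_le _ _).trans (max_le (Polynomial.natDegree_X_pow_le k) ?_)
    refine Polynomial.natDegree_sum_le_of_forall_le _ _ fun i _ => ?_
    exact (Polynomial.natDegree_C_mul_le _ _).trans ((ih i i.isLt).trans i.isLt.le)

theorem natDegree_jacobiPoly_le (a b : ℝ) (k : ℕ) : (jacobiPoly a b k).natDegree ≤ k :=
  (Polynomial.natDegree_C_mul_le _ _).trans (natDegree_monicJacobi_le a b k)

theorem monicJacobi_zero (a b : ℝ) : monicJacobi a b 0 = 1 := by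
  rw [monicJacobi]; simp

theorem sum_quadIncr (a b : ℝ) {X : Type*} [AddCommGroup X] [Module ℝ X] (f : UI → X) (h : ℕ) :
    ∑ i ∈ Finset.range (h + 1), quadIncr a b (2 * i) f = quad a b (2 * h) f := by
  induction h with
  | zero => simp [quadIncr]
  | succ h ih =>
    rw [Finset.sum_range_succ, ih, quadIncr, if_neg (by omega),
      show 2 * (h + 1) - 2 = 2 * h by omega]
    abel

section Univariate

variable {a b : ℝ} [IsProbabilityMeasure (jacobiMeasure a b)]

theorem integrable_jacobi_of_continuous {f : UI → ℝ} (hf : Continuous f) :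
    Integrable f (jacobiMeasure a b) :=
  hf.integrable_of_hasCompactSupport (HasCompactSupport.of_compactSpace f)

theorem continuous_eval_UI (p : Polynomial ℝ) : Continuous fun y : UI => p.eval (y : ℝ) :=
  p.continuous.comp continuous_subtype_val

theorem integral_monicJacobi_mul_eq_zero (k : ℕ) :
    ∀ i < k, ∫ y : UI, (monicJacobi a b k).eval (y : ℝ) * (monicJacobi a b i).eval (y : ℝ)
      ∂jacobiMeasure a b = 0 := by
  induction k using Nat.strong_induction_on with
  | _ k ih =>
    intro i hik
    set c : Fin k → ℝ := fun l =>
      (∫ y : UI, (y : ℝ) ^ k * (monicJacobi a b l).eval (y : ℝ) ∂jacobiMeasure a b) /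
        (∫ y : UI, (monicJacobi a b l).eval (y : ℝ) ^ 2 ∂jacobiMeasure a b) with hc
    have h1 : ∀ y : UI, (monicJacobi a b k).eval (y : ℝ) * (monicJacobi a b i).eval (y : ℝ) =
        (y : ℝ) ^ k * (monicJacobi a b i).eval (y : ℝ) - ∑ l : Fin k,
          c l * ((monicJacobi a b l).eval (y : ℝ) * (monicJacobi a b i).eval (y : ℝ)) := by
      intro y
      rw [monicJacobi]
      simp only [Polynomial.eval_sub, Polynomial.eval_pow, Polynomial.eval_X,
        Polynomial.eval_finsetSum, Polynomial.eval_mul, Polynomial.eval_C, sub_mul,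
        Finset.sum_mul, hc, mul_assoc]
    have hcont : ∀ p q : Polynomial ℝ, Integrable (fun y : UI => p.eval (y : ℝ) * q.eval (y : ℝ))
        (jacobiMeasure a b) := fun p q =>
      integrable_jacobi_of_continuous ((continuous_eval_UI p).mul (continuous_eval_UI q))
    have hpow : Integrable (fun y : UI => (y : ℝ) ^ k * (monicJacobi a b i).eval (y : ℝ))
        (jacobiMeasure a b) := by
      simpa using hcont (Polynomial.X ^ k) (monicJacobi a b i)
    simp_rw [h1]
    rw [integral_sub hpow (integrable_finsetSum _ fun l _ => (hcont _ _).const_mul _),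
      integral_finsetSum _ fun l _ => (hcont _ _).const_mul _]
    simp_rw [integral_const_mul]
    rw [Finset.sum_eq_single ⟨i, hik⟩]
    · simp only [hc]
      have hsq : ∫ y : UI, (monicJacobi a b i).eval (y : ℝ) * (monicJacobi a b i).eval (y : ℝ)
          ∂jacobiMeasure a b = ∫ y : UI, (monicJacobi a b i).eval (y : ℝ) ^ 2
            ∂jacobiMeasure a b := by simp_rw [sq]
      rw [hsq]
      -- If the norm vanishes, the coefficient is `0` by the convention for division by zero, but
      -- then the polynomial is zero almost everywhere and orthogonality is trivial.
      by_cases h0 : ∫ y : UI, (monicJacobi a b i).eval (y : ℝ) ^ 2 ∂jacobiMeasure a b = 0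
      · rw [h0, mul_zero, sub_zero]
        rw [integral_eq_zero_iff_of_nonneg (fun y => sq_nonneg _)
          (by simpa [sq] using hcont (monicJacobi a b i) (monicJacobi a b i))] at h0
        refine integral_eq_zero_of_ae ?_
        filter_upwards [h0] with y hy
        have : (monicJacobi a b i).eval (y : ℝ) = 0 := by simpa using hy
        simp [this]
      · rw [div_mul_cancel₀ _ h0, sub_self]
    · intro l _ hl
      have hl' : (l : ℕ) ≠ i := fun h => hl (Fin.ext h)
      rcases lt_or_gt_of_ne hl' with h | h
      · simp_rw [mul_comm ((monicJacobi a b l).eval _)]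
        rw [ih i hik l h, mul_zero]
      · rw [ih l l.isLt i h, mul_zero]
    · simp

theorem jacobiPoly_zero : jacobiPoly a b 0 = 1 := by
  simp [jacobiPoly, monicJacobi_zero]

theorem integral_jacobiPoly {k : ℕ} :
    ∫ y : UI, (jacobiPoly a b k).eval (y : ℝ) ∂jacobiMeasure a b = if k = 0 then 1 else 0 := by
  split_ifs with hk
  · subst hk; simp [jacobiPoly_zero]
  · have h := integral_monicJacobi_mul_eq_zero (a := a) (b := b) k 0 (Nat.pos_of_ne_zero hk)
    simp only [monicJacobi_zero, Polynomial.eval_one, mul_one] at h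
    simp only [jacobiPoly, Polynomial.eval_mul, Polynomial.eval_C]
    rw [integral_const_mul, h, mul_zero]

theorem continuous_lagrangePoly (m k : ℕ) : Continuous (lagrangePoly m k) := by
  have : lagrangePoly m k = fun y : UI => (lagrangeBasis m k).eval (y : ℝ) := by
    ext y; rw [eval_lagrangeBasis]
  rw [this]
  exact continuous_eval_UI _

/-- The interpolatory quadrature is exact on polynomials of degree at most `m`. -/
theorem quad_eval_eq_integral {m : ℕ} {p : Polynomial ℝ} (hp : p.natDegree ≤ m) :
    quad a b m (fun t : UI => p.eval (t : ℝ)) = ∫ y : UI, p.eval (y : ℝ) ∂jacobiMeasure a b := by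
  have hdeg : p.degree < (Finset.range (m + 1)).card := by
    rw [Finset.card_range]
    exact (Polynomial.degree_le_of_natDegree_le hp).trans_lt (by exact_mod_cast Nat.lt_succ_self m)
  have h := Lagrange.eq_interpolate (chebNode_injOn m) hdeg
  have h1 : ∀ y : UI, p.eval (y : ℝ) =
      ∑ k ∈ Finset.range (m + 1), p.eval (chebNode m k : ℝ) * lagrangePoly m k y := by
    intro y
    conv_lhs => rw [h]
    simp only [Lagrange.interpolate_apply, Polynomial.eval_finsetSum, Polynomial.eval_mul,
      Polynomial.eval_C, ← eval_lagrangeBasis]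
  have h2 : ∫ y : UI, p.eval (y : ℝ) ∂jacobiMeasure a b = ∫ y : UI,
      ∑ k ∈ Finset.range (m + 1), p.eval (chebNode m k : ℝ) * lagrangePoly m k y
        ∂jacobiMeasure a b := by
    congr 1; ext y; exact h1 y
  rw [h2, integral_finsetSum _ fun k _ =>
    (integrable_jacobi_of_continuous (continuous_lagrangePoly m k)).const_mul _]
  unfold quad
  refine Finset.sum_congr rfl fun k _ => ?_
  rw [integral_const_mul, quadWeight, smul_eq_mul, mul_comm]

/-- The weights are integrals of Lagrange polynomials against a probability measure, so the sum of
their absolute values is at most the Lebesgue constant. -/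
theorem abs_quad_le {m : ℕ} {f : UI → ℝ} {A : ℝ} (hf : ∀ y, |f y| ≤ A) :
    |quad a b m f| ≤ 2 * Real.log (2 * (m : ℝ) + 3) * A := by
  have hA : 0 ≤ A := (abs_nonneg _).trans (hf (chebNode 0 0))
  have hint : ∀ k, Integrable (fun y => |lagrangePoly m k y|) (jacobiMeasure a b) := fun k =>
    integrable_jacobi_of_continuous (continuous_lagrangePoly m k).abs
  have h1 : ∑ k ∈ Finset.range (m + 1), |quadWeight a b m k| ≤
      2 * Real.log (2 * (m : ℝ) + 3) := by
    calc ∑ k ∈ Finset.range (m + 1), |quadWeight a b m k|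
        ≤ ∑ k ∈ Finset.range (m + 1), ∫ y, |lagrangePoly m k y| ∂jacobiMeasure a b :=
          Finset.sum_le_sum fun k _ => abs_integral_le_integral_abs
      _ = ∫ y, ∑ k ∈ Finset.range (m + 1), |lagrangePoly m k y| ∂jacobiMeasure a b :=
          (integral_finsetSum _ fun k _ => hint k).symm
      _ ≤ ∫ _, 2 * Real.log (2 * (m : ℝ) + 3) ∂jacobiMeasure a b :=
          integral_mono (integrable_finsetSum _ fun k _ => hint k) (integrable_const _)
            fun y => (sum_abs_lagrangePoly_le m y).trans (two_add_harmonic_le m)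
      _ = _ := by simp
  calc |quad a b m f| ≤ ∑ k ∈ Finset.range (m + 1), |quadWeight a b m k| * A := by
        refine (Finset.abs_sum_le_sum_abs _ _).trans (Finset.sum_le_sum fun k _ => ?_)
        rw [smul_eq_mul, abs_mul]
        exact mul_le_mul_of_nonneg_left (hf _) (abs_nonneg _)
    _ = (∑ k ∈ Finset.range (m + 1), |quadWeight a b m k|) * A := by rw [Finset.sum_mul]
    _ ≤ _ := mul_le_mul_of_nonneg_right h1 hA

/-- The univariate quadrature increment of order `m` of the Jacobi polynomial of degree `k`. -/
def univIncr (a b : ℝ) (m k : ℕ) : ℝ :=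
  quadIncr a b m fun t : UI => (jacobiPoly a b k).eval (t : ℝ)

theorem quadIncr_zero {X : Type*} [AddCommGroup X] [Module ℝ X] (f : UI → X) :
    quadIncr a b 0 f = f (chebNode 0 0) := by
  have : quadWeight a b 0 0 = 1 := by simp [quadWeight, lagrangePoly]
  simp [quadIncr, quad, this]

theorem univIncr_zero_zero : univIncr a b 0 0 = 1 := by
  simp [univIncr, quadIncr_zero, jacobiPoly_zero]

/-- Parity gives `k ≤ m - 2`, so both rules in the increment are exact for `J_k`. -/
theorem univIncr_eq_zero {m k : ℕ} (hm : Even m) (hk : Even k) (h : k < m) :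
    univIncr a b m k = 0 := by
  obtain ⟨i, rfl⟩ := hm
  obtain ⟨l, rfl⟩ := hk
  have hdeg := natDegree_jacobiPoly_le a b (l + l)
  rw [univIncr, quadIncr, if_neg (by omega), quad_eval_eq_integral (hdeg.trans h.le),
    quad_eval_eq_integral (hdeg.trans (by omega)), sub_self]

theorem sum_univIncr (h : ℕ) :
    ∑ i ∈ Finset.range (h + 1), univIncr a b (2 * i) (2 * h) = if h = 0 then 1 else 0 := by
  simp only [univIncr]
  rw [sum_quadIncr, quad_eval_eq_integral (natDegree_jacobiPoly_le a b (2 * h)),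
    integral_jacobiPoly]
  simp

/-- For `k = 2h ≥ 1` and `m ≤ k` the growth assumption bounds `|Q_m J_k|` by `B = (C k + 1)^t`.
There are `h` increments of size at most `2B`, plus `Q_0`, in total `B (1 + k)`. The factor `1 + k`
raises the exponent from `t` to `t + 1`, and the base `1 + (C + 1) k` dominates both factors. -/
theorem sum_abs_univIncr_le {C t : ℝ} (hC : 0 ≤ C) (ht : 0 ≤ t)
    (hgrowth : ∀ k : ℕ, 1 ≤ k → ∀ y : UI,
      2 * |(jacobiPoly a b k).eval (y : ℝ)| * Real.log (2 * (k : ℝ) + 3) ≤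
        (C * (k : ℝ) + 1) ^ t) (h : ℕ) :
    ∑ i ∈ Finset.range (h + 1), |univIncr a b (2 * i) (2 * h)| ≤
      (1 + (C + 1) * ((2 * h : ℕ) : ℝ)) ^ (t + 1) := by
  rcases Nat.eq_zero_or_pos h with rfl | hh
  · simp [univIncr_zero_zero]
  set B : ℝ := (C * ((2 * h : ℕ) : ℝ) + 1) ^ t with hB
  have hB0 : 0 ≤ B := by positivity
  have hlog : 0 < Real.log (2 * ((2 * h : ℕ) : ℝ) + 3) := Real.log_pos (by
    have : (0 : ℝ) ≤ ((2 * h : ℕ) : ℝ) := Nat.cast_nonneg _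
    linarith)
  have hq : ∀ m ≤ 2 * h, |quad a b m fun t : UI => (jacobiPoly a b (2 * h)).eval (t : ℝ)| ≤ B := by
    intro m hm
    have h1 : ∀ y : UI, |(jacobiPoly a b (2 * h)).eval (y : ℝ)| ≤
        B / (2 * Real.log (2 * ((2 * h : ℕ) : ℝ) + 3)) := by
      intro y
      rw [le_div_iff₀ (by positivity)]
      linarith [hgrowth (2 * h) (by omega) y]
    refine (abs_quad_le h1).trans ?_
    have h2 : Real.log (2 * (m : ℝ) + 3) ≤ Real.log (2 * ((2 * h : ℕ) : ℝ) + 3) := by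
      have : (m : ℝ) ≤ ((2 * h : ℕ) : ℝ) := by exact_mod_cast hm
      exact Real.log_le_log (by positivity) (by linarith)
    rw [mul_div_assoc', div_le_iff₀ (by positivity), mul_comm B]
    exact mul_le_mul_of_nonneg_right (by linarith) hB0
  have hsum : ∑ i ∈ Finset.range (h + 1), |univIncr a b (2 * i) (2 * h)| ≤ h * (2 * B) + B := by
    rw [Finset.sum_range_succ']
    refine add_le_add ?_ ?_
    · calc _ ≤ ∑ _i ∈ Finset.range h, (2 * B) := by
            refine Finset.sum_le_sum fun i hi => ?_
            have hi' := Finset.mem_range.mp hi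
            rw [univIncr, quadIncr, if_neg (by omega)]
            refine (abs_sub _ _).trans ?_
            linarith [hq (2 * (i + 1)) (by omega), hq (2 * (i + 1) - 2) (by omega)]
        _ = _ := by simp
    · simpa [univIncr, quadIncr] using hq 0 (by omega)
  refine hsum.trans ?_
  have hx : (0 : ℝ) ≤ ((2 * h : ℕ) : ℝ) := Nat.cast_nonneg _
  have hpos : 0 < 1 + (C + 1) * ((2 * h : ℕ) : ℝ) := by positivity
  rw [Real.rpow_add_one hpos.ne']
  have h3 : B ≤ (1 + (C + 1) * ((2 * h : ℕ) : ℝ)) ^ t :=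
    Real.rpow_le_rpow (by positivity) (by linarith) ht
  have h4 : h * (2 * B) + B = B * (1 + ((2 * h : ℕ) : ℝ)) := by push_cast; ring
  rw [h4]
  refine mul_le_mul h3 ?_ (by positivity) (by positivity)
  nlinarith

theorem abs_jacobiPoly_le {C t : ℝ} (hC : 0 ≤ C) (ht : 0 ≤ t)
    (hgrowth : ∀ k : ℕ, 1 ≤ k → ∀ y : UI,
      2 * |(jacobiPoly a b k).eval (y : ℝ)| * Real.log (2 * (k : ℝ) + 3) ≤
        (C * (k : ℝ) + 1) ^ t) (k : ℕ) (y : UI) :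
    |(jacobiPoly a b k).eval (y : ℝ)| ≤ (1 + (C + 1) * (k : ℝ)) ^ (t + 1) := by
  rcases Nat.eq_zero_or_pos k with rfl | hk
  · simp [jacobiPoly_zero]
  have hx : (0 : ℝ) ≤ (k : ℝ) := Nat.cast_nonneg _
  have h1 : 1 ≤ Real.log (2 * (k : ℝ) + 3) := by
    rw [Real.le_log_iff_exp_le (by positivity)]
    linarith [Real.exp_one_lt_d9]
  have h2 := hgrowth k hk y
  have h3 : |(jacobiPoly a b k).eval (y : ℝ)| ≤ (C * (k : ℝ) + 1) ^ t := by
    nlinarith [abs_nonneg ((jacobiPoly a b k).eval (y : ℝ))]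
  exact h3.trans ((Real.rpow_le_rpow (by positivity) (by linarith) ht).trans
    (Real.rpow_le_rpow_of_exponent_le (by nlinarith) (by linarith)))

end Univariate

/-! ### Tensorized increments -/

section Linearity

variable {X : Type*} [NormedAddCommGroup X] [NormedSpace ℝ X]

theorem quadIncr_smul_const (a b : ℝ) (m : ℕ) (g : UI → ℝ) (w : X) :
    quadIncr a b m (fun t => g t • w) = quadIncr a b m g • w := by
  unfold quadIncr quad
  split_ifs <;> simp [sub_smul, Finset.sum_smul, mul_smul]

theorem quadIncr_const_mul (a b : ℝ) (m : ℕ) (c : ℝ) (g : UI → ℝ) :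
    quadIncr a b m (fun t => c * g t) = c * quadIncr a b m g := by
  simpa [mul_comm] using quadIncr_smul_const a b m g c

theorem quadIncrUpTo_smul_const (a b : ℕ → ℝ) (ν : Idx) (N : ℕ) (g : UIInf → ℝ) (w : X)
    (y : UIInf) :
    quadIncrUpTo a b ν N (fun y => g y • w) y = quadIncrUpTo a b ν N g y • w := by
  induction N generalizing y with
  | zero => rfl
  | succ N ih => simp only [quadIncrUpTo, ih, quadIncr_smul_const]

theorem hasSum_quad {I : Type*} (a b : ℝ) (m : ℕ) {f : I → UI → X} {g : UI → X}
    (h : ∀ t, HasSum (fun i => f i t) (g t)) :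
    HasSum (fun i => quad a b m (f i)) (quad a b m g) :=
  hasSum_sum fun _ _ => (h _).const_smul _

theorem hasSum_quadIncr {I : Type*} (a b : ℝ) (m : ℕ) {f : I → UI → X} {g : UI → X}
    (h : ∀ t, HasSum (fun i => f i t) (g t)) :
    HasSum (fun i => quadIncr a b m (f i)) (quadIncr a b m g) := by
  refine (hasSum_quad a b m h).sub ?_
  split_ifs
  · exact hasSum_zero
  · exact hasSum_quad a b (m - 2) h

theorem hasSum_quadIncrUpTo {I : Type*} (a b : ℕ → ℝ) (ν : Idx) (N : ℕ) {f : I → UIInf → X}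
    {g : UIInf → X} (h : ∀ y, HasSum (fun i => f i y) (g y)) (y : UIInf) :
    HasSum (fun i => quadIncrUpTo a b ν N (f i) y) (quadIncrUpTo a b ν N g y) := by
  induction N generalizing y with
  | zero => exact h y
  | succ N ih => exact hasSum_quadIncr _ _ _ fun t => ih _

end Linearity

/-- The increment `Δ_ν'` of the tensor product Jacobi polynomial `J_ν`. -/
def tensorIncr (a b : ℕ → ℝ) (ν' ν : Idx) : ℝ := tensorQuadIncr a b ν' (jacobiTensor a b ν)

/-- The even multi-indices below `ν`. -/
def evenBelow (ν : Idx) : Finset Idx :=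
  ν.support.finsupp fun j => (Finset.range (ν j / 2 + 1)).image (2 * ·)

theorem mem_evenBelow {ν ν' : Idx} :
    ν' ∈ evenBelow ν ↔ ν' ∈ evenIdx ∧ ν' ≤ ν := by
  rw [evenBelow, Finset.mem_finsupp_iff]
  constructor
  · rintro ⟨h1, h2⟩
    have h3 : ∀ j, Even (ν' j) ∧ ν' j ≤ ν j := by
      intro j
      by_cases hj : j ∈ ν.support
      · obtain ⟨i, hi, h⟩ := Finset.mem_image.mp (h2 j hj)
        rw [Finset.mem_range] at hi
        exact ⟨⟨i, by omega⟩, by omega⟩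
      · have : ν' j = 0 := by
          by_contra h
          exact hj (h1 (Finsupp.mem_support_iff.mpr h))
        simp [this]
    exact ⟨fun j => (h3 j).1, fun j => (h3 j).2⟩
  · rintro ⟨h1, h2⟩
    refine ⟨Finsupp.support_mono h2, fun j _ => ?_⟩
    obtain ⟨i, hi⟩ := h1 j
    have := h2 j
    exact Finset.mem_image.mpr ⟨i, Finset.mem_range.mpr (by omega), by omega⟩

/-- Distributivity: `evenBelow ν` is a box, so sums of product functions factor over the
coordinates. -/
theorem sum_evenBelow_prod (ν : Idx) (F : ℕ → ℕ → ℝ) :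
    ∑ ν' ∈ evenBelow ν, ∏ j ∈ ν.support, F j (ν' j) =
      ∏ j ∈ ν.support, ∑ i ∈ Finset.range (ν j / 2 + 1), F j (2 * i) := by
  classical
  have h : ∀ j ∈ ν.support, ∑ i ∈ Finset.range (ν j / 2 + 1), F j (2 * i) =
      ∑ m ∈ (Finset.range (ν j / 2 + 1)).image (2 * ·), F j m := by
    intro j _
    rw [Finset.sum_image fun x _ y _ hxy => by simpa using hxy]
  rw [Finset.prod_congr rfl h, Finset.prod_sum, evenBelow, Finset.finsupp, Finset.sum_map]
  refine Finset.sum_congr (by congr; exact Subsingleton.elim _ _) fun p _ => ?_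
  rw [← Finset.prod_attach ν.support]
  refine Finset.prod_congr rfl fun j _ => ?_
  simp [Finsupp.indicator_of_mem j.2]

section Tensor

variable {a b : ℕ → ℝ} [∀ j, IsProbabilityMeasure (jacobiMeasure (a j) (b j))]

theorem jacobiTensor_eq_prod {ν : Idx} {s : Finset ℕ} (hs : ν.support ⊆ s) (y : UIInf) :
    jacobiTensor a b ν y = ∏ j ∈ s, (jacobiPoly (a j) (b j) (ν j)).eval (y j : ℝ) := by
  refine Finset.prod_subset hs fun j _ hj => ?_
  rw [Finsupp.notMem_support_iff.mp hj, jacobiPoly_zero, Polynomial.eval_one]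

theorem support_subset_range {ν : Idx} {M : ℕ} (hM : ν.support.sup Nat.succ ≤ M) :
    ν.support ⊆ Finset.range M := fun _ hj =>
  Finset.mem_range.mpr ((Finset.le_sup (f := Nat.succ) hj).trans hM)

theorem quadIncrUpTo_jacobiTensor {ν' ν : Idx} {M : ℕ} (hM : ν.support ⊆ Finset.range M) {N : ℕ}
    (hN : N ≤ M) (y : UIInf) :
    quadIncrUpTo a b ν' N (jacobiTensor a b ν) y =
      (∏ j ∈ Finset.range N, univIncr (a j) (b j) (ν' j) (ν j)) *
        ∏ j ∈ Finset.Ico N M, (jacobiPoly (a j) (b j) (ν j)).eval (y j : ℝ) := by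
  induction N generalizing y with
  | zero => simp [quadIncrUpTo, jacobiTensor_eq_prod hM]
  | succ N ih =>
    have h1 : ∀ t : UI, quadIncrUpTo a b ν' N (jacobiTensor a b ν) (Function.update y N t) =
        ((∏ j ∈ Finset.range N, univIncr (a j) (b j) (ν' j) (ν j)) *
          ∏ j ∈ Finset.Ico (N + 1) M, (jacobiPoly (a j) (b j) (ν j)).eval (y j : ℝ)) *
          (jacobiPoly (a N) (b N) (ν N)).eval (t : ℝ) := by
      intro t
      rw [ih (by omega), Finset.prod_eq_prod_Ico_succ_bot (by omega), Function.update_self]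
      have h2 : ∀ j ∈ Finset.Ico (N + 1) M,
          (jacobiPoly (a j) (b j) (ν j)).eval (Function.update y N t j : ℝ) =
          (jacobiPoly (a j) (b j) (ν j)).eval (y j : ℝ) := by
        intro j hj
        rw [Function.update_of_ne (by have := (Finset.mem_Ico.mp hj).1; omega)]
      rw [Finset.prod_congr rfl h2]
      ring
    simp only [quadIncrUpTo, h1]
    rw [quadIncr_const_mul, Finset.prod_range_succ, ← univIncr]
    ring

theorem tensorIncr_eq_prod_range (ν' ν : Idx) {M : ℕ} (hM : ν.support ⊆ Finset.range M)
    (hM' : ν'.support.sup Nat.succ ≤ M) :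
    tensorIncr a b ν' ν = ∏ j ∈ Finset.range M, univIncr (a j) (b j) (ν' j) (ν j) := by
  rw [tensorIncr, tensorQuadIncr, quadIncrUpTo_jacobiTensor hM hM',
    -- Beyond the support of `ν'` the evaluation at `y_{0,0}` left over by `tensorQuadIncr` is
    -- itself the increment of order `0`.
    ← Finset.prod_range_mul_prod_Ico _ hM']
  congr 1
  refine Finset.prod_congr rfl fun j hj => ?_
  have : ν' j = 0 := by
    by_contra h
    have := Finset.le_sup (f := Nat.succ) (Finsupp.mem_support_iff.mpr h)
    have := (Finset.mem_Ico.mp hj).1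
    omega
  rw [this, univIncr, quadIncr_zero]

theorem tensorIncr_eq_zero {ν' ν : Idx} (hν' : ν' ∈ evenIdx) (hν : ν ∈ evenIdx) (h : ¬ν' ≤ ν) :
    tensorIncr a b ν' ν = 0 := by
  rw [Finsupp.le_def, not_forall] at h
  obtain ⟨j, hj⟩ := h
  rw [tensorIncr_eq_prod_range ν' ν (support_subset_range (le_max_right _ _)) (le_max_left _ _)]
  refine Finset.prod_eq_zero (i := j) ?_ (univIncr_eq_zero (hν' j) (hν j) (by omega))
  refine support_subset_range (le_max_left _ (ν.support.sup Nat.succ)) ?_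
  rw [Finsupp.mem_support_iff]
  omega

theorem tensorIncr_eq_prod {ν' ν : Idx} (h : ν' ≤ ν) :
    tensorIncr a b ν' ν = ∏ j ∈ ν.support, univIncr (a j) (b j) (ν' j) (ν j) := by
  rw [tensorIncr_eq_prod_range ν' ν (support_subset_range (le_max_right _ _)) (le_max_left _ _)]
  symm
  refine Finset.prod_subset (support_subset_range (le_max_right _ _)) fun j _ hj => ?_
  have h0 := Finsupp.notMem_support_iff.mp hj
  have h1 : ν' j = 0 := by have := h j; omega
  rw [h0, h1, univIncr_zero_zero]

theorem sum_tensorIncr {ν : Idx} (hν : ν ∈ evenIdx) :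
    ∑ ν' ∈ evenBelow ν, tensorIncr a b ν' ν = if ν = 0 then 1 else 0 := by
  rw [Finset.sum_congr rfl fun ν' hν' => tensorIncr_eq_prod (mem_evenBelow.mp hν').2,
    sum_evenBelow_prod ν fun j m => univIncr (a j) (b j) m (ν j)]
  split_ifs with h
  · simp [h]
  · obtain ⟨j, hj⟩ := Finsupp.support_nonempty_iff.mpr h
    refine Finset.prod_eq_zero hj ?_
    have h1 := sum_univIncr (a := a j) (b := b j) (ν j / 2)
    have h2 : 2 * (ν j / 2) = ν j := Nat.two_mul_div_two_of_even (hν j)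
    rw [h2] at h1
    rw [h1, if_neg]
    have := Finsupp.mem_support_iff.mp hj
    omega

theorem sum_abs_tensorIncr_le {ν : Idx} (hν : ν ∈ evenIdx) {C t : ℝ} (hC : 0 ≤ C) (ht : 0 ≤ t)
    (hgrowth : ∀ j k : ℕ, 1 ≤ k → ∀ y : UI,
      2 * |(jacobiPoly (a j) (b j) k).eval (y : ℝ)| * Real.log (2 * (k : ℝ) + 3) ≤
        (C * (k : ℝ) + 1) ^ t) :
    ∑ ν' ∈ evenBelow ν, |tensorIncr a b ν' ν| ≤ pWeight (t + 1) (C + 1) ν := by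
  have h0 : ∀ ν' ∈ evenBelow ν, |tensorIncr a b ν' ν| =
      ∏ j ∈ ν.support, |univIncr (a j) (b j) (ν' j) (ν j)| := fun ν' hν' => by
    rw [tensorIncr_eq_prod (mem_evenBelow.mp hν').2, Finset.abs_prod]
  rw [Finset.sum_congr rfl h0, sum_evenBelow_prod ν fun j m => |univIncr (a j) (b j) m (ν j)|]
  refine Finset.prod_le_prod (fun j _ => Finset.sum_nonneg fun _ _ => abs_nonneg _) fun j _ => ?_
  have h1 := sum_abs_univIncr_le hC ht (hgrowth j) (ν j / 2)
  have h2 : 2 * (ν j / 2) = ν j := Nat.two_mul_div_two_of_even (hν j)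
  rwa [h2] at h1

theorem abs_jacobiTensor_le {C t : ℝ} (hC : 0 ≤ C) (ht : 0 ≤ t)
    (hgrowth : ∀ j k : ℕ, 1 ≤ k → ∀ y : UI,
      2 * |(jacobiPoly (a j) (b j) k).eval (y : ℝ)| * Real.log (2 * (k : ℝ) + 3) ≤
        (C * (k : ℝ) + 1) ^ t) (ν : Idx) (y : UIInf) :
    |jacobiTensor a b ν y| ≤ pWeight (t + 1) (C + 1) ν := by
  rw [jacobiTensor, Finset.abs_prod]
  exact Finset.prod_le_prod (fun _ _ => abs_nonneg _) fun j _ =>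
    abs_jacobiPoly_le hC ht (hgrowth j) (ν j) (y j)

end Tensor

theorem continuous_jacobiTensor (a b : ℕ → ℝ) (ν : Idx) : Continuous (jacobiTensor a b ν) := by
  refine continuous_finsetProd _ fun j _ => ?_
  exact (Polynomial.continuous _).comp (continuous_subtype_val.comp (continuous_apply j))

theorem pWeight_pos {θ lam : ℝ} (hlam : 0 ≤ lam) (ν : Idx) : 0 < pWeight θ lam ν :=
  Finset.prod_pos fun j _ => Real.rpow_pos_of_pos (by positivity) _

theorem one_le_pWeight {θ lam : ℝ} (hθ : 0 ≤ θ) (hlam : 0 ≤ lam) (ν : Idx) :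
    1 ≤ pWeight θ lam ν := by
  refine Finset.prod_induction _ (fun x => 1 ≤ x)
    (fun x y hx hy => one_le_mul_of_one_le_of_one_le hx hy) le_rfl fun j _ => ?_
  exact Real.one_le_rpow (by have : 0 ≤ lam * (ν j : ℝ) := by positivity
                             linarith) hθ

/-! ### Weighted summability -/

/-- Each term is the product of `σ c` and `p σ^(-q/2)`, whose squares are summable by the two
assumptions; the square of the second factor is `(p^(2/q) σ⁻¹)^q`. -/
theorem IsWeightedSummable.summable_mul {θ lam q : ℝ} {σ c : Idx → ℝ}
    (h : IsWeightedSummable θ lam q σ c) (hlam : 0 ≤ lam) (hq : 0 < q) (hc : ∀ ν, 0 ≤ c ν) :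
    Summable fun ν : evenIdx => pWeight θ lam ν * (σ ν ^ (1 - q / 2) * c ν) := by
  refine Summable.of_nonneg_of_le (fun ν => ?_) (fun ν => ?_) (h.summable_sq.add h.summable_weight)
  · have h1 := h.one_lt ν ν.2
    have := hc ν
    have := (pWeight_pos (θ := θ) hlam (ν : Idx)).le
    positivity
  · have h1 : 0 < σ ν := by linarith [h.one_lt ν ν.2]
    have h2 := pWeight_pos (θ := θ) hlam (ν : Idx)
    have e1 : (pWeight θ lam ν ^ (2 / q) * (σ ν)⁻¹) ^ q =
        (pWeight θ lam ν * σ ν ^ (-(q / 2))) ^ 2 := by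
      rw [Real.mul_rpow (by positivity) (by positivity), ← Real.rpow_mul h2.le,
        div_mul_cancel₀ _ hq.ne', mul_pow, Real.inv_rpow h1.le, ← Real.rpow_neg h1.le,
        ← Real.rpow_mul_natCast h1.le]
      congr 1
      · exact_mod_cast Real.rpow_natCast _ 2
      · congr 1; push_cast; ring
    have e2 : σ ν ^ (1 - q / 2) = σ ν * σ ν ^ (-(q / 2)) := by
      rw [sub_eq_add_neg, Real.rpow_add h1, Real.rpow_one]
    rw [e1, e2]
    nlinarith [sq_nonneg (σ ν * c ν - pWeight θ lam ν * σ ν ^ (-(q / 2))),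
      sq_nonneg (σ ν * c ν), sq_nonneg (pWeight θ lam ν * σ ν ^ (-(q / 2)))]

theorem IsWeightedSummable.summable_rpow_neg {θ lam q : ℝ} {σ c : Idx → ℝ}
    (h : IsWeightedSummable θ lam q σ c) (hθ : 0 ≤ θ) (hlam : 0 ≤ lam) (hq : 0 < q) :
    Summable fun ν : evenIdx => σ ν ^ (-q) := by
  refine Summable.of_nonneg_of_le (fun ν => ?_) (fun ν => ?_) h.summable_weight
  · have h1 := h.one_lt ν ν.2
    positivity
  · have h1 : 0 < σ ν := by linarith [h.one_lt ν ν.2]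
    have h2 := one_le_pWeight hθ hlam (ν : Idx)
    rw [Real.rpow_neg h1.le, ← Real.inv_rpow h1.le]
    refine Real.rpow_le_rpow (by positivity) ?_ hq.le
    exact le_mul_of_one_le_left (by positivity) (Real.one_le_rpow h2 (by positivity))

/-! ### The continuous representative -/

section Representative

variable {a b : ℕ → ℝ} [∀ j, IsProbabilityMeasure (jacobiMeasure (a j) (b j))]
  {X : Type*} [NormedAddCommGroup X] [NormedSpace ℝ X] [CompleteSpace X]

instance : IsProbabilityMeasure (prodJacobi a b) := by unfold prodJacobi; infer_instance

/-- The series converges absolutely in `C(UIInf, X)`. Its uniform limit and `v` are `L²` limits of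
the same partial sums, hence equal almost everywhere. -/
theorem exists_continuous_representative {v : UIInf → X} (hv : HasEvenGPC a b v) {p : Idx → ℝ}
    (hJ : ∀ ν y, |jacobiTensor a b ν y| ≤ p ν)
    (hs : Summable fun ν : evenIdx => p ν * ‖gpcCoeff a b v ν‖) :
    ∃ vc : C(UIInf, X), v =ᵐ[prodJacobi a b] vc ∧
      ∀ y, HasSum (fun ν : evenIdx => jacobiTensor a b ν y • gpcCoeff a b v ν) (vc y) := by
  set f : evenIdx → C(UIInf, X) := fun ν =>
    ⟨fun y => jacobiTensor a b ν y • gpcCoeff a b v ν,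
      (continuous_jacobiTensor a b ν).smul continuous_const⟩ with hf
  have hsum : Summable f := by
    refine Summable.of_norm_bounded hs fun ν => ?_
    rw [ContinuousMap.norm_le _ (mul_nonneg ((abs_nonneg _).trans (hJ ν fun _ => chebNode 0 0))
      (norm_nonneg _))]
    intro y
    simp only [hf, ContinuousMap.coe_mk, norm_smul, Real.norm_eq_abs]
    exact mul_le_mul_of_nonneg_right (hJ ν y) (norm_nonneg _)
  obtain ⟨vc, hvc⟩ := hsum
  have hpt : ∀ y, HasSum (fun ν : evenIdx => jacobiTensor a b ν y • gpcCoeff a b v ν) (vc y) :=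
    fun y => (ContinuousMap.hasSum_apply hvc y)
  refine ⟨vc, ?_, hpt⟩
  have hmeas : ∀ g : C(UIInf, X), AEStronglyMeasurable g (prodJacobi a b) := fun g =>
    g.continuous.aestronglyMeasurable
  have hconv : Tendsto (fun S : Finset evenIdx =>
      eLpNorm (fun y => vc y - ∑ ν ∈ S, jacobiTensor a b ν y • gpcCoeff a b v ν) 2
        (prodJacobi a b)) atTop (𝓝 0) := by
    have h1 : Tendsto (fun S : Finset evenIdx => ENNReal.ofReal ‖vc - ∑ ν ∈ S, f ν‖) atTop
        (𝓝 0) := by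
      have h2 : Tendsto (fun S : Finset evenIdx => ‖vc - ∑ ν ∈ S, f ν‖) atTop (𝓝 0) := by
        have := (tendsto_const_nhds (x := vc)).sub hvc
        simpa using this.norm
      simpa using ENNReal.tendsto_ofReal h2
    refine tendsto_of_tendsto_of_tendsto_of_le_of_le tendsto_const_nhds h1 (fun _ => zero_le)
      fun S => ?_
    refine (eLpNorm_le_of_ae_bound (C := ‖vc - ∑ ν ∈ S, f ν‖)
      (Eventually.of_forall fun y => ?_)).trans (by simp)
    have := (vc - ∑ ν ∈ S, f ν).norm_coe_le_norm y
    simpa [hf] using this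
  have hdiff : eLpNorm (v - ⇑vc) 2 (prodJacobi a b) = 0 := by
    have h1 := hv.2.add hconv
    rw [add_zero] at h1
    refine le_antisymm (ge_of_tendsto h1 (Eventually.of_forall fun S => ?_)) zero_le
    have hS : AEStronglyMeasurable
        (fun y => ∑ ν ∈ S, jacobiTensor a b ν y • gpcCoeff a b v ν) (prodJacobi a b) := by
      have := hmeas (∑ ν ∈ S, f ν)
      refine this.congr (Eventually.of_forall fun y => ?_)
      simp [hf]
    have h2 := eLpNorm_sub_le (p := 2) (hv.1.1.sub hS) ((hmeas vc).sub hS) (by norm_num)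
    refine le_trans (le_of_eq ?_) h2
    congr 1
    ext y
    simp
  rw [eLpNorm_eq_zero_iff (hv.1.1.sub (hmeas vc)) (by norm_num)] at hdiff
  filter_upwards [hdiff] with y hy
  exact sub_eq_zero.mp hy

end Representative

/-! ### Error representation of the fully discrete quadrature -/

section Error

variable {𝕜 : Type*} [RCLike 𝕜]
  {X₁ : Type*} [NormedAddCommGroup X₁] [InnerProductSpace 𝕜 X₁]
  {X₂ : Type*} [NormedAddCommGroup X₂] [InnerProductSpace 𝕜 X₂]

/-- The partial sum `∑_{k < M} δ_k`. -/
def spatialPartial (P : ℕ → X₁ →ₗ[𝕜] X₁) (M : ℕ) (x : X₁) : X₁ :=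
  ∑ k ∈ Finset.range M, spatialIncr P k x

theorem spatialPartial_succ (P : ℕ → X₁ →ₗ[𝕜] X₁) (M : ℕ) (x : X₁) :
    spatialPartial P (M + 1) x = P (2 ^ M) x := by
  induction M with
  | zero => simp [spatialPartial, spatialIncr]
  | succ M ih =>
    rw [spatialPartial, Finset.sum_range_succ, ← spatialPartial, ih]
    simp [spatialIncr]

/-- For `M ≥ 1` the partial sum is `P_{2^(M-1)}`; the shift by one level costs `2^α`. For `M = 0`
nothing is subtracted, and `‖ι‖` is the bound. -/
theorem IsSpatialApprox.exists_norm_sub_spatialPartial_le {ι : X₂ →L[𝕜] X₁}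
    {V : ℕ → Submodule 𝕜 X₁} {P : ℕ → X₁ →ₗ[𝕜] X₁} {α : ℝ} (hP : IsSpatialApprox ι V P α) :
    ∃ K > 0, ∀ (M : ℕ) (w : X₂),
      ‖ι w - spatialPartial P M (ι w)‖ ≤ K * ((2 : ℝ) ^ M) ^ (-α) * ‖w‖ := by
  obtain ⟨C₂, hC₂, h⟩ := hP.consistent
  have h2α : (0 : ℝ) < 2 ^ α := by positivity
  refine ⟨‖ι‖ + C₂ * 2 ^ α, by positivity, fun M w => ?_⟩
  rcases M with _ | M
  · simp only [spatialPartial, Finset.range_zero, Finset.sum_empty, sub_zero, pow_zero,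
      Real.one_rpow, mul_one]
    refine (ι.le_opNorm w).trans (mul_le_mul_of_nonneg_right ?_ (norm_nonneg _))
    have : 0 < C₂ * (2 : ℝ) ^ α := by positivity
    linarith
  · rw [spatialPartial_succ]
    refine (h (2 ^ M) Nat.one_le_two_pow w).trans (mul_le_mul_of_nonneg_right ?_ (norm_nonneg _))
    have e : (2 : ℝ) ^ α * ((2 : ℝ) ^ (M + 1)) ^ (-α) = ((2 : ℝ) ^ M) ^ (-α) := by
      rw [pow_succ, Real.mul_rpow (by positivity) (by norm_num), mul_left_comm,
        ← Real.rpow_add (by norm_num)]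
      simp
    push_cast
    rw [add_mul, mul_assoc C₂, e]
    have : 0 ≤ ‖ι‖ * ((2 : ℝ) ^ (M + 1)) ^ (-α) := by positivity
    linarith

/-- The increments `δ_k ∘ ι` as continuous linear maps. -/
theorem IsSpatialApprox.exists_spatialIncr_comp {ι : X₂ →L[𝕜] X₁}
    {V : ℕ → Submodule 𝕜 X₁} {P : ℕ → X₁ →ₗ[𝕜] X₁} {α : ℝ} (hP : IsSpatialApprox ι V P α)
    (k : ℕ) : ∃ D : X₂ →L[𝕜] X₁, ∀ w, D w = spatialIncr P k (ι w) := by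
  obtain ⟨C₁, hC₁, h⟩ := hP.stable
  have hA : ∀ m, ∃ A : X₂ →L[𝕜] X₁, ∀ w, A w = P m (ι w) := fun m =>
    ⟨LinearMap.mkContinuous (P m ∘ₗ (ι : X₂ →ₗ[𝕜] X₁)) (C₁ * ‖ι‖) fun w => by
      refine (h m w).trans ?_
      rw [mul_assoc]
      exact mul_le_mul_of_nonneg_left (ι.le_opNorm w) hC₁.le, fun w => rfl⟩
  choose A hA using hA
  rcases k with _ | k
  · exact ⟨A 1, fun w => hA 1 w⟩
  · exact ⟨A (2 ^ (k + 1)) - A (2 ^ k), fun w => by simp [hA, spatialIncr]⟩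

variable [NormedSpace ℝ X₁] [IsScalarTower ℝ 𝕜 X₁] [NormedSpace ℝ X₂] [IsScalarTower ℝ 𝕜 X₂]
  {a b : ℕ → ℝ} [∀ j, IsProbabilityMeasure (jacobiMeasure (a j) (b j))]

/-- The exact value `ι (w 0)` is written as the full sum of increments of every `J_ν` by
`sum_tensorIncr`. The quadrature involves finitely many point values and continuous maps `δ_k ∘ ι`,
so it passes through the series; its terms with `ν' ≰ ν` vanish, and the others regroup into the
partial sums up to `M ν'`. -/
theorem hasSum_error {ι : X₂ →L[𝕜] X₁}
    {V : ℕ → Submodule 𝕜 X₁} {P : ℕ → X₁ →ₗ[𝕜] X₁} {α : ℝ} (hP : IsSpatialApprox ι V P α)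
    {w : Idx → X₂} {vc : UIInf → X₂}
    (hvc : ∀ y, HasSum (fun ν : evenIdx => jacobiTensor a b ν y • w ν) (vc y))
    {G : Set (ℕ × Idx)} (hG : G.Finite) (hGe : ∀ p ∈ G, p.2 ∈ evenIdx) {M : Idx → ℕ}
    (hM : ∀ ν ∈ evenIdx, ∀ k, (k, ν) ∈ G ↔ k < M ν) :
    HasSum (fun ν : evenIdx => ∑ ν' ∈ evenBelow ν,
        tensorIncr a b ν' ν • (ι (w ν) - spatialPartial P (M ν') (ι (w ν))))
      (ι (w 0) - smolyakQuad a b ι P G vc) := by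
  classical
  choose D hD using hP.exists_spatialIncr_comp
  have hlin : ∀ (k : ℕ) (r : ℝ) (x : X₂),
      spatialIncr P k (ι (r • x)) = r • spatialIncr P k (ι x) := fun k r x => by
    rw [← hD, ← hD]
    exact (D k).map_smul_of_tower r x
  have h1 : ∀ ν', HasSum (fun ν : evenIdx => tensorIncr a b ν' ν • w ν)
      (tensorQuadIncr a b ν' vc) := fun ν' => by
    have := hasSum_quadIncrUpTo a b ν' (ν'.support.sup Nat.succ) hvc fun _ => chebNode 0 0
    simp only [quadIncrUpTo_smul_const] at this
    exact this
  have h2 : HasSum (fun ν : evenIdx => ∑ p ∈ hG.toFinset,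
      tensorIncr a b p.2 ν • spatialIncr P p.1 (ι (w ν))) (smolyakQuad a b ι P G vc) := by
    rw [smolyakQuad, finsum_mem_eq_finite_toFinset_sum _ hG]
    refine hasSum_sum fun p _ => ?_
    have := (D p.1).hasSum (h1 p.2)
    simpa only [hD, hlin, Function.comp_def] using this
  have h3 : HasSum (fun ν : evenIdx => (∑ ν' ∈ evenBelow ν, tensorIncr a b ν' ν) • ι (w ν))
      (ι (w 0)) := by
    have h0 : (0 : Idx) ∈ evenIdx := fun j => by simp
    have := hasSum_single (f := fun ν : evenIdx =>
      (∑ ν' ∈ evenBelow ν, tensorIncr a b ν' ν) • ι (w ν)) ⟨0, h0⟩ (fun ν hν => by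
        have h4 : (ν : Idx) ≠ 0 := fun h => hν (Subtype.ext h)
        rw [sum_tensorIncr ν.2, if_neg h4, zero_smul])
    simpa only [sum_tensorIncr h0, if_true, one_smul] using this
  refine (h3.sub h2).congr_fun ?_
  intro ν
  simp only [smul_sub, Finset.sum_sub_distrib, ← Finset.sum_smul]
  congr 1
  have h4 : ∀ ν' ∈ evenBelow ν, tensorIncr a b ν' ν • spatialPartial P (M ν') (ι (w ν)) =
      ∑ k ∈ Finset.range (M ν'), tensorIncr a b ν' ν • spatialIncr P k (ι (w ν)) :=
    fun ν' _ => by rw [spatialPartial, Finset.smul_sum]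
  rw [Finset.sum_congr rfl h4, Finset.sum_sigma']
  have h5 : ∑ p ∈ hG.toFinset, tensorIncr a b p.2 ν • spatialIncr P p.1 (ι (w ν)) =
      ∑ p ∈ hG.toFinset with p.2 ∈ evenBelow ν,
        tensorIncr a b p.2 ν • spatialIncr P p.1 (ι (w ν)) := by
    symm
    refine Finset.sum_filter_of_ne fun p hp hne => ?_
    by_contra hp2
    have hpe := hGe p (hG.mem_toFinset.mp hp)
    have : ¬p.2 ≤ ν := fun h => hp2 (mem_evenBelow.mpr ⟨hpe, h⟩)
    exact hne (by rw [tensorIncr_eq_zero hpe ν.2 this, zero_smul])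
  rw [h5]
  refine Finset.sum_nbij' (fun p => (p.2, p.1)) (fun p => ⟨p.2, p.1⟩) ?_ ?_ (fun _ _ => rfl)
    (fun _ _ => rfl) (fun _ _ => rfl)
  · rintro ⟨ν', k⟩ hp
    rw [Finset.mem_sigma, Finset.mem_range] at hp
    rw [Finset.mem_filter, hG.mem_toFinset]
    exact ⟨(hM _ (mem_evenBelow.mp hp.1).1 _).mpr hp.2, hp.1⟩
  · rintro ⟨k, ν'⟩ hp
    rw [Finset.mem_filter, hG.mem_toFinset] at hp
    rw [Finset.mem_sigma, Finset.mem_range]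
    exact ⟨hp.2, (hM _ (mem_evenBelow.mp hp.2).1 _).mp hp.1⟩

theorem norm_integral_sub_smolyakQuad_le {ι : X₂ →L[𝕜] X₁}
    {V : ℕ → Submodule 𝕜 X₁} {P : ℕ → X₁ →ₗ[𝕜] X₁} {α : ℝ} (hP : IsSpatialApprox ι V P α)
    {w : Idx → X₂} {vc : UIInf → X₂}
    (hvc : ∀ y, HasSum (fun ν : evenIdx => jacobiTensor a b ν y • w ν) (vc y))
    {G : Set (ℕ × Idx)} (hG : G.Finite) (hGe : ∀ p ∈ G, p.2 ∈ evenIdx) {M : Idx → ℕ}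
    (hM : ∀ ν ∈ evenIdx, ∀ k, (k, ν) ∈ G ↔ k < M ν) {p B : Idx → ℝ} {S : ℝ}
    (hp : ∀ ν ∈ evenIdx, ∑ ν' ∈ evenBelow ν, |tensorIncr a b ν' ν| ≤ p ν)
    (hB0 : ∀ ν ∈ evenIdx, 0 ≤ B ν)
    (hB : ∀ ν ∈ evenIdx, ∀ ν' ∈ evenIdx, ν' ≤ ν →
      ‖ι (w ν) - spatialPartial P (M ν') (ι (w ν))‖ ≤ B ν)
    (hS : HasSum (fun ν : evenIdx => p ν * B ν) S) :
    ‖ι (w 0) - smolyakQuad a b ι P G vc‖ ≤ S := by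
  rw [← (hasSum_error hP hvc hG hGe hM).tsum_eq]
  refine tsum_of_norm_bounded hS fun ν => ?_
  calc _ ≤ ∑ ν' ∈ evenBelow ν, |tensorIncr a b ν' ν| * B ν := by
        refine (norm_sum_le _ _).trans (Finset.sum_le_sum fun ν' hν' => ?_)
        obtain ⟨h1, h2⟩ := mem_evenBelow.mp hν'
        rw [norm_smul, Real.norm_eq_abs]
        exact mul_le_mul_of_nonneg_left (hB ν ν.2 ν' h1 h2) (abs_nonneg _)
    _ ≤ _ := by
        rw [← Finset.sum_mul]
        exact mul_le_mul_of_nonneg_right (hp ν ν.2) (hB0 ν ν.2)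

/-! ### Dimension of the approximation space -/

theorem rank_approxSpace_le (a b : ℕ → ℝ) {V : ℕ → Submodule 𝕜 X₁}
    (hV : ∀ m, Module.rank 𝕜 (V m) ≤ (m : Cardinal)) (F : Finset (ℕ × Idx)) :
    Module.rank 𝕜 (approxSpace a b V (F : Set (ℕ × Idx))) ≤ ((∑ p ∈ F, 2 ^ p.1 : ℕ) : Cardinal) := by
  classical
  have hcomm : ∀ (r : ℝ) (c : 𝕜) (x : X₁), r • c • x = c • r • x := fun r c x => by
    rw [← algebraMap_smul 𝕜 r, ← algebraMap_smul 𝕜 r x, smul_comm]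
  let L : ℕ × Idx → X₁ →ₗ[𝕜] (UIInf → X₁) := fun p =>
    { toFun := fun w y => jacobiTensor a b p.2 y • w
      map_add' := fun w w' => by ext y; simp
      map_smul' := fun c w => by ext y; simp [hcomm] }
  induction F using Finset.induction_on with
  | empty =>
    have : approxSpace a b V ((∅ : Finset (ℕ × Idx)) : Set (ℕ × Idx)) = ⊥ := by
      simp only [approxSpace, Finset.coe_empty, Set.mem_empty_iff_false, false_and, exists_false,
        Set.ofPred_false, Submodule.span_empty]
    rw [this]
    simp
  | insert p F hp ih =>
    have h1 : approxSpace a b V ((insert p F : Finset (ℕ × Idx)) : Set (ℕ × Idx)) ≤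
        (V (2 ^ p.1)).map (L p) ⊔ approxSpace a b V (F : Set (ℕ × Idx)) := by
      refine Submodule.span_le.mpr ?_
      rintro f ⟨p', hp', w, hw, rfl⟩
      rcases Finset.mem_insert.mp (Finset.mem_coe.mp hp') with rfl | h
      · exact Submodule.mem_sup_left ⟨w, hw, rfl⟩
      · exact Submodule.mem_sup_right (Submodule.subset_span ⟨p', h, w, hw, rfl⟩)
    refine (Submodule.rank_mono h1).trans ((Submodule.rank_add_le_rank_add_rank _ _).trans ?_)
    rw [Finset.sum_insert hp]
    push_cast
    push_cast at ih
    refine add_le_add ?_ ih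
    refine (rank_map_le _ _).trans ((hV _).trans ?_)
    push_cast
    exact le_rfl

end Error

/-! ### Thresholded index sets -/

theorem exists_forall_iff_lt {p : ℕ → Prop} (hanti : ∀ k, p (k + 1) → p k) (hne : ∃ k, ¬p k) :
    ∃ M, ∀ k, p k ↔ k < M := by
  classical
  refine ⟨Nat.find hne, fun k => ⟨fun hk => ?_, fun hk => ?_⟩⟩
  · by_contra h
    have h1 : ∀ i, p (Nat.find hne + i) → p (Nat.find hne) := by
      intro i
      induction i with
      | zero => exact id
      | succ i ih => exact fun hi => ih (hanti _ hi)
    refine Nat.find_spec hne (h1 (k - Nat.find hne) ?_)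
    rwa [Nat.add_sub_cancel' (not_lt.mp h)]
  · exact not_not.mp (Nat.find_min hne hk)

/-- A geometric sum is below twice its last term, so a bound on the top level of a fibre bounds the
cost of the whole fibre. -/
theorem sum_two_pow_le {M : ℕ} {Y : ℝ} (hY : 0 ≤ Y) (h : ∀ k < M, 2 * (2 : ℝ) ^ k ≤ Y) :
    ∑ k ∈ Finset.range M, (2 : ℝ) ^ k ≤ Y := by
  rcases M with _ | M
  · simpa using hY
  · refine le_trans ?_ (h M (Nat.lt_succ_self M))
    rw [geom_sum_eq (by norm_num), pow_succ]
    norm_num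
    linarith

section Counting

variable {σ : Idx → ℝ} {q : ℝ}

theorem finite_rpow_le (hσ : ∀ ν ∈ evenIdx, 1 < σ ν)
    (hs : Summable fun ν : evenIdx => σ ν ^ (-q)) {Y : ℝ} (hY : 0 < Y) :
    {ν : evenIdx | σ ν ^ q ≤ Y}.Finite := by
  have h := (hs.tendsto_cofinite_zero).eventually (gt_mem_nhds (inv_pos.mpr hY))
  refine (Filter.eventually_cofinite.mp h).subset fun ν hν => ?_
  have h1 : 0 < σ ν := by linarith [hσ ν ν.2]
  rw [Set.mem_ofPred_eq, not_lt, Real.rpow_neg h1.le]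
  exact inv_anti₀ (by positivity) hν

/-- Markov's inequality: each `ν ∈ F` contributes at least `Y⁻¹` to `∑ σ_ν^(-q)`. -/
theorem card_le_of_rpow_le (hσ : ∀ ν ∈ evenIdx, 1 < σ ν)
    (hs : Summable fun ν : evenIdx => σ ν ^ (-q)) {Y : ℝ} (hY : 0 < Y) {F : Finset evenIdx}
    (hF : ∀ ν ∈ F, σ ν ^ q ≤ Y) :
    (F.card : ℝ) ≤ Y * ∑' ν : evenIdx, σ ν ^ (-q) := by
  have h1 : ∀ ν : evenIdx, 0 < σ ν := fun ν => by linarith [hσ ν ν.2]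
  have h2 : (F.card : ℝ) * Y⁻¹ ≤ ∑ ν ∈ F, σ ν ^ (-q) := by
    rw [← nsmul_eq_mul]
    refine Finset.card_nsmul_le_sum _ _ _ fun ν hν => ?_
    rw [Real.rpow_neg (h1 ν).le]
    exact inv_anti₀ (Real.rpow_pos_of_pos (h1 ν) _) (hF ν hν)
  have h3 := hs.sum_le_tsum F fun ν _ => (Real.rpow_pos_of_pos (h1 ν) _).le
  have h4 := h2.trans h3
  rw [← div_eq_mul_inv, div_le_iff₀ hY] at h4
  linarith

end Counting

section Spaces

variable {𝕜 : Type*} [RCLike 𝕜]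
  {X₁ : Type*} [NormedAddCommGroup X₁] [InnerProductSpace 𝕜 X₁]
  {X₂ : Type*} [NormedAddCommGroup X₂] [InnerProductSpace 𝕜 X₂]
  [NormedSpace ℝ X₁] [IsScalarTower ℝ 𝕜 X₁] [NormedSpace ℝ X₂] [IsScalarTower ℝ 𝕜 X₂]

theorem finite_and_rank_approxSpace_le (a b : ℕ → ℝ) {V : ℕ → Submodule 𝕜 X₁}
    (hV : ∀ m, Module.rank 𝕜 (V m) ≤ (m : Cardinal)) {G : Set (ℕ × Idx)}
    (hGe : ∀ p ∈ G, p.2 ∈ evenIdx) {M : Idx → ℕ} (hM : ∀ ν ∈ evenIdx, ∀ k, (k, ν) ∈ G ↔ k < M ν)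
    {F : Finset evenIdx} (hF : ∀ ν : evenIdx, 0 < M ν → ν ∈ F) :
    G.Finite ∧ ∀ n : ℕ, ∑ ν ∈ F, ∑ k ∈ Finset.range (M ν), (2 : ℝ) ^ k ≤ n →
      Module.rank 𝕜 (approxSpace a b V G) ≤ (n : Cardinal) := by
  classical
  set T : Finset (ℕ × Idx) :=
    (F.sigma fun ν => Finset.range (M ν)).map ⟨fun p => (p.2, (p.1 : Idx)), by
      rintro ⟨ν, k⟩ ⟨ν', k'⟩ h
      obtain ⟨rfl, h⟩ := Prod.mk.inj h
      obtain rfl := Subtype.ext h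
      rfl⟩ with hT
  have hGT : G = T := by
    ext ⟨k, ν⟩
    rw [Finset.mem_coe, hT, Finset.mem_map]
    constructor
    · intro h
      have hν := hGe _ h
      have hk := (hM ν hν k).mp h
      exact ⟨⟨⟨ν, hν⟩, k⟩, Finset.mem_sigma.mpr ⟨hF ⟨ν, hν⟩ (by simpa using by omega),
        Finset.mem_range.mpr hk⟩, rfl⟩
    · rintro ⟨⟨ν', k'⟩, h, h'⟩
      obtain ⟨rfl, rfl⟩ := Prod.mk.inj h'
      exact (hM _ ν'.2 _).mpr (Finset.mem_range.mp (Finset.mem_sigma.mp h).2)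
  refine ⟨hGT ▸ T.finite_toSet, fun n hn => ?_⟩
  rw [hGT]
  refine (rank_approxSpace_le a b hV T).trans ?_
  have : (∑ p ∈ T, 2 ^ p.1 : ℕ) ≤ n := by
    rw [hT, Finset.sum_map, Finset.sum_sigma]
    exact_mod_cast hn
  exact_mod_cast this

variable {a b : ℕ → ℝ} [∀ j, IsProbabilityMeasure (jacobiMeasure (a j) (b j))]
  {ι : X₂ →L[𝕜] X₁} {V : ℕ → Submodule 𝕜 X₁} {P : ℕ → X₁ →ₗ[𝕜] X₁} {α : ℝ}
  {w : Idx → X₂} {vc : UIInf → X₂} {θ lam q₁ q₂ : ℝ} {σ₁ σ₂ : Idx → ℝ}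

/-- The fibre over `ν` costs at most `2 ξ σ₂^(-q₂)`, which is summable, so the dimension is `O(ξ)`.
Failure of the threshold at level `M ν'` yields the spatial factor `ξ^(-α) σ₂^(α q₂)`. -/
theorem indexSet_estimates_of_le (hP : IsSpatialApprox ι V P α)
    (hvc : ∀ y, HasSum (fun ν : evenIdx => jacobiTensor a b ν y • w ν) (vc y))
    (hθ : 0 ≤ θ) (hlam : 0 ≤ lam)
    (hp : ∀ ν ∈ evenIdx, ∑ ν' ∈ evenBelow ν, |tensorIncr a b ν' ν| ≤ pWeight θ lam ν)
    (hq₂ : 0 < q₂) (hσ₂ : IsWeightedSummable θ lam q₂ σ₂ fun ν => ‖w ν‖)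
    (hσ₂_mono : MonotoneOn σ₂ evenIdx) (hα : α ≤ 1 / q₂ - 1 / 2) :
    ∃ D > 0, ∃ S ≥ 0, ∀ ξ : ℝ, 1 < ξ → (indexSet α q₁ q₂ σ₁ σ₂ ξ).Finite ∧
      (∀ n : ℕ, D * ξ ≤ n →
        Module.rank 𝕜 (approxSpace a b V (indexSet α q₁ q₂ σ₁ σ₂ ξ)) ≤ (n : Cardinal)) ∧
      ‖ι (w 0) - smolyakQuad a b ι P (indexSet α q₁ q₂ σ₁ σ₂ ξ) vc‖ ≤ S * ξ ^ (-α) := by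
  obtain ⟨K, hK, hPK⟩ := hP.exists_norm_sub_spatialPartial_le
  have hα0 := hP.alpha_pos
  have hsum := hσ₂.summable_mul hlam hq₂ fun ν => norm_nonneg (w ν)
  have hcount := hσ₂.summable_rpow_neg hθ hlam hq₂
  have hpos : ∀ ν ∈ evenIdx, 0 < σ₂ ν := fun ν hν => by linarith [hσ₂.one_lt ν hν]
  set Z := ∑' ν : evenIdx, σ₂ ν ^ (-q₂) with hZ
  have hZ0 : 0 ≤ Z := tsum_nonneg fun ν => (Real.rpow_pos_of_pos (hpos ν ν.2) _).le
  set S₀ := ∑' ν : evenIdx, pWeight θ lam ν * (σ₂ ν ^ (1 - q₂ / 2) * ‖w ν‖) with hS₀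
  have hS₀0 : 0 ≤ S₀ := tsum_nonneg fun ν => by
    have := (pWeight_pos (θ := θ) hlam (ν : Idx)).le
    have := hpos ν ν.2
    positivity
  refine ⟨2 * Z + 1, by linarith, K * S₀, by positivity, fun ξ hξ => ?_⟩
  have hξ0 : 0 < ξ := by linarith
  set G := indexSet α q₁ q₂ σ₁ σ₂ ξ with hG
  have hmem : ∀ ν ∈ evenIdx, ∀ k, (k, ν) ∈ G ↔ (2 : ℝ) ^ k * σ₂ ν ^ q₂ ≤ ξ := fun ν hν k => by
    simp only [hG, indexSet, Set.mem_ofPred_eq, hν, true_and]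
    rw [if_pos hα]
  have hGe : ∀ p ∈ G, p.2 ∈ evenIdx := fun p hp => hp.1
  have hex : ∀ ν, ∃ M, ν ∈ evenIdx → ∀ k, (2 : ℝ) ^ k * σ₂ ν ^ q₂ ≤ ξ ↔ k < M := by
    intro ν
    by_cases hν : ν ∈ evenIdx
    · have hσ := Real.rpow_pos_of_pos (hpos ν hν) q₂
      obtain ⟨M, hM⟩ := exists_forall_iff_lt (p := fun k => (2 : ℝ) ^ k * σ₂ ν ^ q₂ ≤ ξ)
        (fun k hk => le_trans (mul_le_mul_of_nonneg_right
          (pow_le_pow_right₀ (by norm_num) (Nat.le_succ k)) hσ.le) hk) (by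
          obtain ⟨k, hk⟩ := pow_unbounded_of_one_lt (ξ / σ₂ ν ^ q₂) (by norm_num : (1 : ℝ) < 2)
          exact ⟨k, by rw [div_lt_iff₀ hσ] at hk; exact not_le.mpr hk⟩)
      exact ⟨M, fun _ => hM⟩
    · exact ⟨0, fun h => absurd h hν⟩
  choose M hM' using hex
  have hM : ∀ ν ∈ evenIdx, ∀ k, (k, ν) ∈ G ↔ k < M ν := fun ν hν k =>
    (hmem ν hν k).trans (hM' ν hν k)
  have hfin := finite_rpow_le hσ₂.one_lt hcount hξ0
  obtain ⟨hGf, hrank⟩ := finite_and_rank_approxSpace_le (𝕜 := 𝕜) a b hP.rank_le hGe hM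
    (F := hfin.toFinset) fun ν h0 => by
      rw [hfin.mem_toFinset]
      simpa using (hM' ν ν.2 0).mpr h0
  refine ⟨hGf, fun n hn => hrank n ?_, ?_⟩
  · calc ∑ ν ∈ hfin.toFinset, ∑ k ∈ Finset.range (M ν), (2 : ℝ) ^ k
        ≤ ∑ ν ∈ hfin.toFinset, 2 * ξ * σ₂ ν ^ (-q₂) := by
          refine Finset.sum_le_sum fun ν _ => ?_
          have hσ := Real.rpow_pos_of_pos (hpos ν ν.2) q₂
          rw [Real.rpow_neg (hpos ν ν.2).le]
          refine sum_two_pow_le (by positivity) fun k hk => ?_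
          have := (hM' ν ν.2 k).mpr hk
          rw [← div_eq_mul_inv, le_div_iff₀ hσ]
          linarith
      _ = 2 * ξ * ∑ ν ∈ hfin.toFinset, σ₂ ν ^ (-q₂) := by rw [Finset.mul_sum]
      _ ≤ 2 * ξ * Z := mul_le_mul_of_nonneg_left
          (hcount.sum_le_tsum _ fun ν _ => (Real.rpow_pos_of_pos (hpos ν ν.2) _).le) (by positivity)
      _ ≤ (2 * Z + 1) * ξ := by linarith
      _ ≤ n := hn
  · refine norm_integral_sub_smolyakQuad_le hP hvc hGf hGe hM hp
      (B := fun ν => K * ξ ^ (-α) * (σ₂ ν ^ (1 - q₂ / 2) * ‖w ν‖)) (fun ν hν => ?_)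
      (fun ν hν ν' hν' hle => ?_) ?_
    · have := hpos ν hν
      positivity
    · have h1 := hpos ν hν
      have h2 := hpos ν' hν'
      have h3 : ξ < (2 : ℝ) ^ M ν' * σ₂ ν' ^ q₂ := by
        by_contra h
        exact lt_irrefl _ ((hM' ν' hν' _).mp (not_lt.mp h))
      have h4 : ((2 : ℝ) ^ M ν') ^ (-α) ≤ ξ ^ (-α) * σ₂ ν ^ (1 - q₂ / 2) := by
        have h5 : ((2 : ℝ) ^ M ν' * σ₂ ν' ^ q₂) ^ (-α) ≤ ξ ^ (-α) :=
          Real.rpow_le_rpow_of_nonpos hξ0 h3.le (by linarith)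
        rw [Real.mul_rpow (by positivity) (by positivity), ← Real.rpow_mul h2.le, mul_neg,
          Real.rpow_neg h2.le, ← div_eq_mul_inv, div_le_iff₀ (Real.rpow_pos_of_pos h2 _)] at h5
        refine h5.trans (mul_le_mul_of_nonneg_left ?_ (by positivity))
        refine (Real.rpow_le_rpow h2.le (hσ₂_mono hν' hν hle) (by positivity)).trans
          (Real.rpow_le_rpow_of_exponent_le (hσ₂.one_lt ν hν).le ?_)
        -- The case assumption says exactly `α q₂ ≤ 1 - q₂/2`; as `σ₂ > 1`, the exponent may be
        -- raised to the summable one.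
        have h6 := mul_le_mul_of_nonneg_left hα hq₂.le
        rw [mul_sub, mul_one_div_cancel hq₂.ne'] at h6
        linarith
      refine (hPK (M ν') (w ν)).trans ?_
      have := mul_le_mul_of_nonneg_right (mul_le_mul_of_nonneg_left h4 hK.le) (norm_nonneg (w ν))
      linarith
    · have := hsum.hasSum.mul_left (K * ξ ^ (-α))
      rw [← hS₀] at this
      convert! this using 1
      · ext ν; ring
      · ring

/-- The cut `σ₁^q₁ ≤ Ξ` limits the active indices, the other threshold their spatial levels. Each
truncation has its own error, `Ξ^(-s)` and `ξ^(-s)` with `s = 1/q₁ - 1/2`, paid for by the `X₁` and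
`X₂` summability respectively. -/
theorem indexSet_estimates_of_lt (hP : IsSpatialApprox ι V P α)
    (hvc : ∀ y, HasSum (fun ν : evenIdx => jacobiTensor a b ν y • w ν) (vc y))
    (hθ : 0 ≤ θ) (hlam : 0 ≤ lam)
    (hp : ∀ ν ∈ evenIdx, ∑ ν' ∈ evenBelow ν, |tensorIncr a b ν' ν| ≤ pWeight θ lam ν)
    (hq₁ : 0 < q₁) (hq₁₂ : q₁ ≤ q₂) (hq₂ : q₂ < 2)
    (hσ₁ : IsWeightedSummable θ lam q₁ σ₁ fun ν => ‖ι (w ν)‖)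
    (hσ₂ : IsWeightedSummable θ lam q₂ σ₂ fun ν => ‖w ν‖)
    (hσ₁_mono : MonotoneOn σ₁ evenIdx) (hσ₂_mono : MonotoneOn σ₂ evenIdx)
    (hα : 1 / q₂ - 1 / 2 < α) :
    ∃ D > 0, ∃ S ≥ 0, ∀ ξ Ξ : ℝ, 1 < ξ → Ξ = ξ * Real.log ξ ^ (1 / q₁ - 1 / 2)⁻¹ →
      (indexSet α q₁ q₂ σ₁ σ₂ ξ).Finite ∧
      (∀ n : ℕ, D * (ξ ^ ((1 / q₁ - 1 / 2) / α) * Ξ ^ (1 - (1 / q₂ - 1 / 2) / α)) ≤ n →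
        Module.rank 𝕜 (approxSpace a b V (indexSet α q₁ q₂ σ₁ σ₂ ξ)) ≤ (n : Cardinal)) ∧
      ‖ι (w 0) - smolyakQuad a b ι P (indexSet α q₁ q₂ σ₁ σ₂ ξ) vc‖ ≤
        S * (ξ ^ (-(1 / q₁ - 1 / 2)) + Ξ ^ (-(1 / q₁ - 1 / 2))) := by
  obtain ⟨K, hK, hPK⟩ := hP.exists_norm_sub_spatialPartial_le
  have hα0 := hP.alpha_pos
  have hq₂0 : 0 < q₂ := hq₁.trans_le hq₁₂
  set s := 1 / q₁ - 1 / 2 with hs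
  set r := 1 / q₂ - 1 / 2 with hr
  have hqs : q₁ * s = 1 - q₁ / 2 := by rw [hs]; field_simp
  have hqr : q₂ * r = 1 - q₂ / 2 := by rw [hr]; field_simp
  have hr0 : 0 < r := by
    have : 0 < q₂ * r := by rw [hqr]; linarith
    exact pos_of_mul_pos_right this hq₂0.le
  have hs0 : 0 < s := by
    have : 0 < q₁ * s := by rw [hqs]; linarith
    exact pos_of_mul_pos_right this hq₁.le
  have hsum₁ := hσ₁.summable_mul hlam hq₁ fun ν => norm_nonneg (ι (w ν))
  have hsum₂ := hσ₂.summable_mul hlam hq₂0 fun ν => norm_nonneg (w ν)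
  have hcount₁ := hσ₁.summable_rpow_neg hθ hlam hq₁
  have hcount₂ := hσ₂.summable_rpow_neg hθ hlam hq₂0
  have hpos₁ : ∀ ν ∈ evenIdx, 0 < σ₁ ν := fun ν hν => by linarith [hσ₁.one_lt ν hν]
  have hpos₂ : ∀ ν ∈ evenIdx, 0 < σ₂ ν := fun ν hν => by linarith [hσ₂.one_lt ν hν]
  set Z₁ := ∑' ν : evenIdx, σ₁ ν ^ (-q₁) with hZ₁
  have hZ₁0 : 0 ≤ Z₁ := tsum_nonneg fun ν => (Real.rpow_pos_of_pos (hpos₁ ν ν.2) _).le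
  set Z₂ := ∑' ν : evenIdx, σ₂ ν ^ (-q₂) with hZ₂
  have hZ₂0 : 0 ≤ Z₂ := tsum_nonneg fun ν => (Real.rpow_pos_of_pos (hpos₂ ν ν.2) _).le
  set S₁ := ∑' ν : evenIdx, pWeight θ lam ν * (σ₁ ν ^ (1 - q₁ / 2) * ‖ι (w ν)‖) with hS₁
  have hS₁0 : 0 ≤ S₁ := tsum_nonneg fun ν => by
    have := (pWeight_pos (θ := θ) hlam (ν : Idx)).le
    have := hpos₁ ν ν.2
    positivity
  set S₂ := ∑' ν : evenIdx, pWeight θ lam ν * (σ₂ ν ^ (1 - q₂ / 2) * ‖w ν‖) with hS₂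
  have hS₂0 : 0 ≤ S₂ := tsum_nonneg fun ν => by
    have := (pWeight_pos (θ := θ) hlam (ν : Idx)).le
    have := hpos₂ ν ν.2
    positivity
  refine ⟨2 * (Z₁ + Z₂) + 1, by linarith, S₁ + K * S₂, by positivity, fun ξ Ξ hξ hΞ => ?_⟩
  have hξ0 : 0 < ξ := by linarith
  have hlog : 0 < Real.log ξ := Real.log_pos hξ
  have hΞ0 : 0 < Ξ := by rw [hΞ]; positivity
  set τ := 2 * α / (2 - q₂) with hτ
  have h2q : 0 < 2 - q₂ := by linarith
  have hτ0 : 0 < τ := by positivity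
  set ϑ := 2 / (2 - q₂) * s with hϑ
  have hατ : α / τ = 1 - q₂ / 2 := by rw [hτ]; field_simp
  have hτinv : 1 / τ = q₂ * r / α := by rw [hqr, ← hατ]; field_simp
  have hϑτ : ϑ / τ = s / α := by rw [hϑ, hτ]; field_simp
  set G := indexSet α q₁ q₂ σ₁ σ₂ ξ with hG
  have hmem : ∀ ν ∈ evenIdx, ∀ k : ℕ, (k, ν) ∈ G ↔
      (σ₁ ν ^ q₁ ≤ Ξ ∧ (2 : ℝ) ^ (τ * k) * σ₂ ν ≤ ξ ^ ϑ) := fun ν hν k => by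
    rw [hΞ]
    simp only [hG, indexSet, Set.mem_ofPred_eq, hν, true_and]
    rw [if_neg (not_le.mpr hα)]
  have hGe : ∀ p ∈ G, p.2 ∈ evenIdx := fun p hp => hp.1
  have hex : ∀ ν, ∃ M, ν ∈ evenIdx → ∀ k : ℕ,
      (σ₁ ν ^ q₁ ≤ Ξ ∧ (2 : ℝ) ^ (τ * k) * σ₂ ν ≤ ξ ^ ϑ) ↔ k < M := by
    intro ν
    by_cases hν : ν ∈ evenIdx
    · have hσ := hpos₂ ν hν
      obtain ⟨M, hM⟩ := exists_forall_iff_lt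
        (p := fun k : ℕ => (σ₁ ν ^ q₁ ≤ Ξ ∧ (2 : ℝ) ^ (τ * k) * σ₂ ν ≤ ξ ^ ϑ))
        (fun k hk => ⟨hk.1, le_trans (mul_le_mul_of_nonneg_right
          (Real.rpow_le_rpow_of_exponent_le (by norm_num)
            (mul_le_mul_of_nonneg_left (by push_cast; linarith) hτ0.le)) hσ.le) hk.2⟩) (by
          obtain ⟨k, hk⟩ := pow_unbounded_of_one_lt (ξ ^ ϑ / σ₂ ν)
            (Real.one_lt_rpow (by norm_num : (1 : ℝ) < 2) hτ0)
          refine ⟨k, fun h => not_le.mpr hk ?_⟩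
          rw [le_div_iff₀ hσ, ← Real.rpow_mul_natCast (by norm_num)]
          exact h.2)
      exact ⟨M, fun _ => hM⟩
    · exact ⟨0, fun h => absurd h hν⟩
  choose M hM' using hex
  have hM : ∀ ν ∈ evenIdx, ∀ k, (k, ν) ∈ G ↔ k < M ν := fun ν hν k =>
    (hmem ν hν k).trans (hM' ν hν k)
  have hfin := finite_rpow_le hσ₁.one_lt hcount₁ hΞ0
  obtain ⟨hGf, hrank⟩ := finite_and_rank_approxSpace_le (𝕜 := 𝕜) a b hP.rank_le hGe hM
    (F := hfin.toFinset) fun ν h0 => by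
      rw [hfin.mem_toFinset]
      exact ((hM' ν ν.2 0).mpr h0).1
  refine ⟨hGf, fun n hn => hrank n ?_, ?_⟩
  -- A fibre costs `2 ξ^(s/α) σ₂^(-1/τ)`, where `1/τ = q₂ r/α` is smaller than the summable exponent
  -- `q₂`. Indices with `σ₂^q₂ ≥ Ξ` are handled by counting, those below by `∑ σ₂^(-q₂)`; both give
  -- `Ξ^(1 - r/α)`.
  · have hterm : ∀ ν : evenIdx, σ₂ ν ^ (-(1 / τ)) ≤
        Ξ ^ (-(r / α)) + σ₂ ν ^ (-q₂) * Ξ ^ (1 - r / α) := by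
      intro ν
      have h0 := hpos₂ ν ν.2
      have hq := Real.rpow_pos_of_pos h0 q₂
      have e1 : σ₂ ν ^ (-(1 / τ)) = (σ₂ ν ^ q₂) ^ (-(r / α)) := by
        rw [← Real.rpow_mul h0.le, hτinv]; congr 1; ring
      rcases le_total Ξ (σ₂ ν ^ q₂) with h | h
      · have h1 : (σ₂ ν ^ q₂) ^ (-(r / α)) ≤ Ξ ^ (-(r / α)) :=
          Real.rpow_le_rpow_of_nonpos hΞ0 h (by have : 0 < r / α := by positivity
                                                linarith)
        have h2 : 0 ≤ σ₂ ν ^ (-q₂) * Ξ ^ (1 - r / α) := by positivity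
        rw [e1]; linarith
      · have h1 : (σ₂ ν ^ q₂) ^ (1 - r / α) ≤ Ξ ^ (1 - r / α) :=
          Real.rpow_le_rpow hq.le h (by
            have : r / α < 1 := by rw [div_lt_one hα0]; exact hα
            linarith)
        have h2 : 0 ≤ Ξ ^ (-(r / α)) := by positivity
        have h3 : (σ₂ ν ^ q₂) ^ (-(r / α)) = σ₂ ν ^ (-q₂) * (σ₂ ν ^ q₂) ^ (1 - r / α) := by
          rw [sub_eq_add_neg, Real.rpow_add hq, Real.rpow_one, ← mul_assoc, ← Real.rpow_add h0]
          simp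
        have h4 : 0 ≤ σ₂ ν ^ (-q₂) := by positivity
        rw [e1, h3]
        have := mul_le_mul_of_nonneg_left h1 h4
        linarith
    have hcard := card_le_of_rpow_le hσ₁.one_lt hcount₁ hΞ0 (F := hfin.toFinset)
      fun ν hν => hfin.mem_toFinset.mp hν
    have hΞr : Ξ * Ξ ^ (-(r / α)) = Ξ ^ (1 - r / α) := by
      rw [sub_eq_add_neg, Real.rpow_add hΞ0, Real.rpow_one]
    calc ∑ ν ∈ hfin.toFinset, ∑ k ∈ Finset.range (M ν), (2 : ℝ) ^ k
        ≤ ∑ ν ∈ hfin.toFinset, 2 * (ξ ^ (s / α) * σ₂ ν ^ (-(1 / τ))) := by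
          refine Finset.sum_le_sum fun ν _ => ?_
          have h0 := hpos₂ ν ν.2
          refine sum_two_pow_le (by positivity) fun k hk => ?_
          have h1 := ((hM' ν ν.2 k).mpr hk).2
          refine mul_le_mul_of_nonneg_left ?_ (by norm_num)
          have h2 : ((2 : ℝ) ^ (τ * k)) ^ (1 / τ) ≤ (ξ ^ ϑ * (σ₂ ν)⁻¹) ^ (1 / τ) := by
            refine Real.rpow_le_rpow (by positivity) ?_ (by positivity)
            rwa [← div_eq_mul_inv, le_div_iff₀ h0]
          rw [Real.mul_rpow (by positivity) (by positivity), ← Real.rpow_mul (by norm_num),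
            ← Real.rpow_mul hξ0.le, Real.inv_rpow h0.le, ← Real.rpow_neg h0.le,
            mul_one_div ϑ, hϑτ, show τ * (k : ℝ) * (1 / τ) = k by field_simp,
            Real.rpow_natCast] at h2
          exact h2
      _ ≤ ∑ ν ∈ hfin.toFinset, 2 * (ξ ^ (s / α) *
            (Ξ ^ (-(r / α)) + σ₂ ν ^ (-q₂) * Ξ ^ (1 - r / α))) :=
          Finset.sum_le_sum fun ν _ => mul_le_mul_of_nonneg_left
            (mul_le_mul_of_nonneg_left (hterm ν) (by positivity)) (by norm_num)
      _ = 2 * (ξ ^ (s / α) * (hfin.toFinset.card * Ξ ^ (-(r / α)) +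
            (∑ ν ∈ hfin.toFinset, σ₂ ν ^ (-q₂)) * Ξ ^ (1 - r / α))) := by
          rw [← Finset.mul_sum, ← Finset.mul_sum, Finset.sum_add_distrib, Finset.sum_const,
            nsmul_eq_mul, Finset.sum_mul]
      _ ≤ 2 * (ξ ^ (s / α) * (Ξ * Z₁ * Ξ ^ (-(r / α)) + Z₂ * Ξ ^ (1 - r / α))) := by
          have h1 := hcount₂.sum_le_tsum hfin.toFinset
            fun ν _ => (Real.rpow_pos_of_pos (hpos₂ ν ν.2) _).le
          gcongr
      _ = 2 * (Z₁ + Z₂) * (ξ ^ (s / α) * Ξ ^ (1 - r / α)) := by rw [← hΞr]; ring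
      _ ≤ (2 * (Z₁ + Z₂) + 1) * (ξ ^ (s / α) * Ξ ^ (1 - r / α)) :=
          mul_le_mul_of_nonneg_right (by linarith) (by positivity)
      _ ≤ n := hn
  · have hbound : ‖ι (w 0) - smolyakQuad a b ι P G vc‖ ≤ Ξ ^ (-s) * S₁ + K * ξ ^ (-s) * S₂ := by
      refine norm_integral_sub_smolyakQuad_le hP hvc hGf hGe hM hp
        (B := fun ν => Ξ ^ (-s) * (σ₁ ν ^ (1 - q₁ / 2) * ‖ι (w ν)‖) +
          K * ξ ^ (-s) * (σ₂ ν ^ (1 - q₂ / 2) * ‖w ν‖)) (fun ν hν => ?_)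
        (fun ν hν ν' hν' hle => ?_) ?_
      · have := hpos₁ ν hν
        have := hpos₂ ν hν
        positivity
      · have h1 := hpos₁ ν hν
        have h2 := hpos₂ ν hν
        have h3 := hpos₂ ν' hν'
        -- If `ν'` survives the first cut, the error is spatial; otherwise its fibre is empty and
        -- the whole of `ι (w ν)` must be small because `σ₁ ν ≥ σ₁ ν'` is large.
        by_cases hc : σ₁ ν' ^ q₁ ≤ Ξ
        · have h4 : ξ ^ ϑ < (2 : ℝ) ^ (τ * M ν') * σ₂ ν' := by
            by_contra h
            exact lt_irrefl _ ((hM' ν' hν' _).mp ⟨hc, not_lt.mp h⟩)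
          have h5 : ((2 : ℝ) ^ M ν') ^ (-α) ≤ ξ ^ (-s) * σ₂ ν ^ (1 - q₂ / 2) := by
            have h6 : ((2 : ℝ) ^ (τ * M ν') * σ₂ ν') ^ (-(α / τ)) ≤ (ξ ^ ϑ) ^ (-(α / τ)) :=
              Real.rpow_le_rpow_of_nonpos (by positivity) h4.le (by
                have : 0 < α / τ := by positivity
                linarith)
            have e1 : ϑ * -(α / τ) = -s := by
              rw [show ϑ * -(α / τ) = -(α * (ϑ / τ)) by ring, hϑτ]; field_simp
            have e2 : τ * (M ν' : ℝ) * -(α / τ) = M ν' * -α := by field_simp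
            rw [Real.mul_rpow (by positivity) h3.le, ← Real.rpow_mul (by norm_num),
              ← Real.rpow_mul hξ0.le, e1, e2, Real.rpow_neg h3.le, ← div_eq_mul_inv,
              div_le_iff₀ (Real.rpow_pos_of_pos h3 _), Real.rpow_mul (by norm_num),
              Real.rpow_natCast, hατ] at h6
            refine h6.trans (mul_le_mul_of_nonneg_left ?_ (by positivity))
            exact Real.rpow_le_rpow h3.le (hσ₂_mono hν' hν hle) (by linarith)
          have h7 := mul_le_mul_of_nonneg_right (mul_le_mul_of_nonneg_left h5 hK.le)
            (norm_nonneg (w ν))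
          have h8 : 0 ≤ Ξ ^ (-s) * (σ₁ ν ^ (1 - q₁ / 2) * ‖ι (w ν)‖) := by positivity
          linarith [hPK (M ν') (w ν)]
        · have hM0 : M ν' = 0 := by
            by_contra h
            exact hc ((hM' ν' hν' 0).mpr (Nat.pos_of_ne_zero h)).1
          have h4 : Ξ < σ₁ ν ^ q₁ := (not_le.mp hc).trans_le
            (Real.rpow_le_rpow (hpos₁ ν' hν').le (hσ₁_mono hν' hν hle) hq₁.le)
          have h5 : 1 ≤ Ξ ^ (-s) * σ₁ ν ^ (1 - q₁ / 2) := by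
            rw [← hqs, Real.rpow_mul h1.le, Real.rpow_neg hΞ0.le, ← div_eq_inv_mul,
              one_le_div (by positivity)]
            exact Real.rpow_le_rpow hΞ0.le h4.le hs0.le
          have h6 : 0 ≤ K * ξ ^ (-s) * (σ₂ ν ^ (1 - q₂ / 2) * ‖w ν‖) := by positivity
          have h7 := mul_le_mul_of_nonneg_right h5 (norm_nonneg (ι (w ν)))
          simp only [hM0, spatialPartial, Finset.range_zero, Finset.sum_empty, sub_zero]
          linarith
      · have := (hsum₁.hasSum.mul_left (Ξ ^ (-s))).add (hsum₂.hasSum.mul_left (K * ξ ^ (-s)))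
        rw [← hS₁, ← hS₂] at this
        convert! this using 1
        ext ν; ring
    refine hbound.trans ?_
    have h1 : 0 ≤ ξ ^ (-s) := by positivity
    have h2 : 0 ≤ Ξ ^ (-s) := by positivity
    have h3 := mul_nonneg hS₁0 h1
    have h4 := mul_nonneg (mul_nonneg hK.le hS₂0) h2
    linarith

end Spaces

/-! ### Choice of the threshold -/

/-- A single threshold admissible for every `n` handles the finitely many exceptional `n`: its error
is one fixed number, divided by the positive values `R n`. -/
theorem exists_uniform_const {good : ℝ → ℕ → Prop} {err : ℝ → ℝ} {R : ℕ → ℝ} {H : ℕ → Prop}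
    (hR : ∀ n, H n → 0 < R n) (hsmall : ∃ ξ, ∀ n, good ξ n)
    (hlarge : ∃ C, ∀ᶠ n in atTop, H n → ∃ ξ, good ξ n ∧ err ξ ≤ C * R n) :
    ∃ C > 0, ∀ n, H n → ∃ ξ, good ξ n ∧ err ξ ≤ C * R n := by
  obtain ⟨ξ₀, hξ₀⟩ := hsmall
  obtain ⟨C, hC⟩ := hlarge
  obtain ⟨N, hN⟩ := eventually_atTop.mp hC
  have hterm : ∀ n, 0 ≤ |err ξ₀| / |R n| := fun n => by positivity
  have hsum : 0 ≤ ∑ n ∈ Finset.range N, |err ξ₀| / |R n| := Finset.sum_nonneg fun n _ => hterm n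
  refine ⟨|C| + ∑ n ∈ Finset.range N, |err ξ₀| / |R n| + 1, by positivity, fun n hn => ?_⟩
  have hRn := hR n hn
  rcases le_or_gt N n with h | h
  · obtain ⟨ξ, h1, h2⟩ := hN n h hn
    refine ⟨ξ, h1, h2.trans (mul_le_mul_of_nonneg_right ?_ hRn.le)⟩
    linarith [le_abs_self C]
  · refine ⟨ξ₀, hξ₀ n, ?_⟩
    have h1 := Finset.single_le_sum (fun n _ => hterm n) (Finset.mem_range.mpr h)
    have h2 : |err ξ₀| / |R n| * R n = |err ξ₀| := by
      rw [abs_of_pos hRn, div_mul_cancel₀ _ hRn.ne']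
    calc err ξ₀ ≤ |err ξ₀| / |R n| * R n := by rw [h2]; exact le_abs_self _
      _ ≤ _ := mul_le_mul_of_nonneg_right (by linarith [abs_nonneg C]) hRn.le

/-- The solution of `D ξ^A (log ξ)^B ≲ n`, and the size of `ξ^(-s)` for it. -/
theorem eventually_exists_threshold {D A B s : ℝ} (hD : 0 < D) (hA : 1 ≤ A) (hB : 0 ≤ B) :
    ∃ C ≥ 0, ∀ᶠ n : ℕ in atTop, ∃ ξ : ℝ, Real.exp 1 ≤ ξ ∧
      D * (ξ ^ A * Real.log ξ ^ B) ≤ n ∧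
      ξ ^ (-s) ≤ C * ((n : ℝ) ^ (-(s / A)) * Real.log n ^ (B * s / A)) := by
  have hA0 : 0 < A := by linarith
  set D' := max D 1 with hD'
  have hD'1 : 1 ≤ D' := le_max_right _ _
  have hD'0 : 0 < D' := by linarith
  refine ⟨D' ^ (s / A), by positivity, ?_⟩
  -- This provides `Y ≥ exp A` below, and hence `ξ = Y^(1/A) ≥ e`.
  have hlittle : ∀ᶠ x : ℝ in atTop, D' * Real.exp A * Real.log x ^ B ≤ x := by
    have h := (isLittleO_log_rpow_rpow_atTop B (zero_lt_one' ℝ)).bound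
      (c := (D' * Real.exp A)⁻¹) (by positivity)
    filter_upwards [h, eventually_ge_atTop 1] with x hx hx1
    have hl : 0 ≤ Real.log x := Real.log_nonneg hx1
    rw [Real.rpow_one, Real.norm_of_nonneg (by positivity), Real.norm_of_nonneg (by linarith),
      ← div_eq_inv_mul, le_div_iff₀ (by positivity)] at hx
    linarith
  filter_upwards [tendsto_natCast_atTop_atTop.eventually hlittle, eventually_ge_atTop 3]
    with n hn hn3
  have hn3' : (3 : ℝ) ≤ n := by exact_mod_cast hn3
  have hn0 : (0 : ℝ) < n := by linarith
  set L := Real.log n with hL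
  have hL1 : 1 ≤ L := by
    rw [hL, Real.le_log_iff_exp_le hn0]
    linarith [Real.exp_one_lt_d9]
  have hLB : 1 ≤ L ^ B := Real.one_le_rpow hL1 hB
  -- The witness replaces `log ξ` by `log n` in the equation and solves for `ξ^A`. This is
  -- legitimate because `A ≥ 1` and `Y ≥ 1` give `ξ ≤ Y ≤ n`.
  set Y := (n : ℝ) / (D' * L ^ B) with hY
  have hY0 : 0 < Y := by positivity
  have hYe : Real.exp A ≤ Y := by
    rw [hY, le_div_iff₀ (by positivity)]
    linarith
  have hYn : Y ≤ n := by
    rw [hY]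
    exact div_le_self hn0.le (one_le_mul_of_one_le_of_one_le hD'1 hLB)
  have hY1 : 1 ≤ Y := le_trans (Real.one_le_exp hA0.le) hYe
  have hξe : Real.exp 1 ≤ Y ^ (1 / A) := by
    have := Real.rpow_le_rpow (Real.exp_pos A).le hYe (by positivity : 0 ≤ 1 / A)
    rwa [← Real.exp_mul, mul_one_div_cancel hA0.ne'] at this
  have hξn : Y ^ (1 / A) ≤ n := by
    refine le_trans ?_ hYn
    have := Real.rpow_le_rpow_of_exponent_le hY1 ((div_le_one hA0).mpr hA)
    rwa [Real.rpow_one] at this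
  have hξ0 : 0 < Y ^ (1 / A) := by positivity
  have hlog0 : 0 ≤ Real.log (Y ^ (1 / A)) :=
    Real.log_nonneg (le_trans (Real.one_le_exp zero_le_one) hξe)
  refine ⟨Y ^ (1 / A), hξe, ?_, ?_⟩
  · have h1 : Real.log (Y ^ (1 / A)) ^ B ≤ L ^ B :=
      Real.rpow_le_rpow hlog0 (Real.log_le_log hξ0 hξn) hB
    have h2 : (Y ^ (1 / A)) ^ A = Y := by
      rw [← Real.rpow_mul hY0.le, one_div_mul_cancel hA0.ne', Real.rpow_one]
    rw [h2]
    calc D * (Y * Real.log (Y ^ (1 / A)) ^ B) ≤ D' * (Y * L ^ B) :=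
          mul_le_mul (le_max_left _ _) (mul_le_mul_of_nonneg_left h1 hY0.le) (by positivity) hD'0.le
      _ = n := by rw [hY]; field_simp
  · refine le_of_eq ?_
    have hL0 : 0 < L := by linarith
    rw [← Real.rpow_mul hY0.le, hY, Real.div_rpow hn0.le (by positivity),
      Real.mul_rpow hD'0.le (by positivity), ← Real.rpow_mul hL0.le,
      show 1 / A * -s = -(s / A) by ring, Real.rpow_neg hD'0.le,
      show B * -(s / A) = -(B * s / A) by ring, Real.rpow_neg hL0.le]
    field_simp

theorem integral_comp_eq_gpcCoeff_zero {𝕜 : Type*} [RCLike 𝕜]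
    {X₁ : Type*} [NormedAddCommGroup X₁] [InnerProductSpace 𝕜 X₁] [CompleteSpace X₁]
    [NormedSpace ℝ X₁] [IsScalarTower ℝ 𝕜 X₁]
    {X₂ : Type*} [NormedAddCommGroup X₂] [InnerProductSpace 𝕜 X₂] [CompleteSpace X₂]
    [NormedSpace ℝ X₂] [IsScalarTower ℝ 𝕜 X₂] (ι : X₂ →L[𝕜] X₁) {a b : ℕ → ℝ} {v : UIInf → X₂}
    (hv : Integrable v (prodJacobi a b)) :
    ∫ y, ι (v y) ∂prodJacobi a b = ι (gpcCoeff a b v 0) := by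
  have h := ContinuousLinearMap.integral_comp_comm (ι.restrictScalars ℝ) hv
  simpa [gpcCoeff, jacobiTensor] using h

theorem finite_and_rank_approxSpace_le_of_eq_empty {𝕜 : Type*} [RCLike 𝕜]
    {X₁ : Type*} [NormedAddCommGroup X₁] [InnerProductSpace 𝕜 X₁] [NormedSpace ℝ X₁]
    [IsScalarTower ℝ 𝕜 X₁] (a b : ℕ → ℝ) {V : ℕ → Submodule 𝕜 X₁}
    (hV : ∀ m, Module.rank 𝕜 (V m) ≤ (m : Cardinal)) {G : Set (ℕ × Idx)} (hG : G = ∅) (n : ℕ) :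
    G.Finite ∧ Module.rank 𝕜 (approxSpace a b V G) ≤ (n : Cardinal) := by
  subst hG
  refine ⟨Set.finite_empty, ?_⟩
  have := rank_approxSpace_le a b hV ∅
  rw [Finset.coe_empty] at this
  exact this.trans (by simp)

/-- In the first case `ξ` is taken below `σ₂(0)^q₂`, the smallest value of `σ₂^q₂`; in the second,
`ξ (log ξ)^η → 0` as `ξ ↓ 1`, whereas `σ₁^q₁ > 1`. -/
theorem exists_indexSet_eq_empty {α q₁ q₂ : ℝ} {σ₁ σ₂ : Idx → ℝ} (hq₁ : 0 < q₁)
    (hq₁₂ : q₁ ≤ q₂) (hq₂ : q₂ < 2)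
    (hσ₁ : ∀ ν ∈ evenIdx, 1 < σ₁ ν) (hσ₂ : ∀ ν ∈ evenIdx, 1 < σ₂ ν)
    (hσ₂_mono : MonotoneOn σ₂ evenIdx) :
    ∃ ξ : ℝ, 1 < ξ ∧ indexSet α q₁ q₂ σ₁ σ₂ ξ = ∅ := by
  have hq₂0 : 0 < q₂ := hq₁.trans_le hq₁₂
  have h0 : (0 : Idx) ∈ evenIdx := fun j => by simp
  by_cases h : α ≤ 1 / q₂ - 1 / 2
  · obtain ⟨ξ, h1, h2⟩ := exists_between (Real.one_lt_rpow (hσ₂ 0 h0) hq₂0)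
    refine ⟨ξ, h1, Set.eq_empty_iff_forall_notMem.mpr ?_⟩
    rintro ⟨k, ν⟩ ⟨hν, h3⟩
    rw [if_pos h] at h3
    have h4 : σ₂ 0 ^ q₂ ≤ σ₂ ν ^ q₂ := Real.rpow_le_rpow (by linarith [hσ₂ 0 h0])
      (hσ₂_mono h0 hν (zero_le : (0 : Idx) ≤ ν)) hq₂0.le
    have h5 : (1 : ℝ) ≤ 2 ^ k := one_le_pow₀ (by norm_num)
    have h6 : 0 < σ₂ ν ^ q₂ := Real.rpow_pos_of_pos (by linarith [hσ₂ ν hν]) _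
    have h7 := le_mul_of_one_le_left h6.le h5
    exact absurd (h4.trans (h7.trans h3)) (not_le.mpr h2)
  · have hs : 0 < (1 / q₁ - 1 / 2)⁻¹ := by
      have : 1 / 2 < 1 / q₁ := one_div_lt_one_div_of_lt hq₁ (by linarith)
      exact inv_pos.mpr (by linarith)
    have hcont : ContinuousAt (fun ξ : ℝ => ξ * Real.log ξ ^ (1 / q₁ - 1 / 2)⁻¹) 1 :=
      continuousAt_id.mul ((Real.continuousAt_log one_ne_zero).rpow_const (Or.inr hs.le))
    have h1 : ∀ᶠ ξ : ℝ in 𝓝 1, ξ * Real.log ξ ^ (1 / q₁ - 1 / 2)⁻¹ < 1 := by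
      refine hcont.eventually (gt_mem_nhds ?_)
      simp only [Real.log_one, Real.zero_rpow hs.ne', mul_zero, zero_lt_one]
    obtain ⟨ξ, h2, h3⟩ := ((h1.filter_mono nhdsWithin_le_nhds).and
      (self_mem_nhdsWithin : Set.Ioi (1 : ℝ) ∈ 𝓝[>] 1)).exists
    refine ⟨ξ, h3, Set.eq_empty_iff_forall_notMem.mpr ?_⟩
    rintro ⟨k, ν⟩ ⟨hν, h4⟩
    rw [if_neg h] at h4
    exact absurd (Real.one_lt_rpow (hσ₁ ν hν) hq₁) (not_lt.mpr (h4.1.trans h2.le))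

end JacobiQuadrature

end

open JacobiQuadrature

/-! ### The main theorem: choice of the threshold as a function of `n`. -/

theorem mainTheorem2 {𝕜 : Type*} [RCLike 𝕜]
    {X₁ : Type*} [NormedAddCommGroup X₁] [InnerProductSpace 𝕜 X₁] [CompleteSpace X₁]
    [NormedSpace ℝ X₁] [IsScalarTower ℝ 𝕜 X₁]
    {X₂ : Type*} [NormedAddCommGroup X₂] [InnerProductSpace 𝕜 X₂] [CompleteSpace X₂]
    [NormedSpace ℝ X₂] [IsScalarTower ℝ 𝕜 X₂]
    (ι : X₂ →L[𝕜] X₁) (hι : Function.Injective ι)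
    (a b : ℕ → ℝ) (hab : ∀ j, a j = b j)
    (ha_lower : ∃ r : ℝ, -1 < r ∧ ∀ j, r ≤ a j) (ha_upper : BddAbove (Set.range a))
    (ε : ℝ) (hε : 0 < ε) (Cε : ℝ) (hCε : IsGrowthConst a b ε Cε)
    (α : ℝ) (V : ℕ → Submodule 𝕜 X₁) (P : ℕ → X₁ →ₗ[𝕜] X₁)
    (hP : IsSpatialApprox ι V P α)
    (v : UIInf → X₂) (hv : HasEvenGPC a b v)
    (q₁ q₂ : ℝ) (hq₁ : 0 < q₁) (hq₁₂ : q₁ ≤ q₂) (hq₂ : q₂ < 2)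
    (σ₁ σ₂ : Idx → ℝ)
    (hσ₁ : IsWeightedSummable (thetaZero a b + 1 + ε) (Cε + 1) q₁ σ₁
      fun ν => ‖ι (gpcCoeff a b v ν)‖)
    (hσ₂ : IsWeightedSummable (thetaZero a b + 1 + ε) (Cε + 1) q₂ σ₂
      fun ν => ‖gpcCoeff a b v ν‖)
    (hσ₁_mono : 1 / q₂ - 1 / 2 < α → MonotoneOn σ₁ evenIdx)
    (hσ₂_mono : MonotoneOn σ₂ evenIdx) :
    ∃ vc : C(UIInf, X₂), v =ᵐ[prodJacobi a b] vc ∧ ∃ C > 0,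
      (∀ n : ℕ, 1 ≤ n → (1 / q₂ - 1 / 2 < α → 2 ≤ n) →
        ∃ ξ : ℝ, 1 < ξ ∧ (indexSet α q₁ q₂ σ₁ σ₂ ξ).Finite ∧
          Module.rank 𝕜 (approxSpace a b V (indexSet α q₁ q₂ σ₁ σ₂ ξ)) ≤ (n : Cardinal) ∧
          ‖(∫ y, ι (v y) ∂prodJacobi a b) -
              smolyakQuad a b ι P (indexSet α q₁ q₂ σ₁ σ₂ ξ) vc‖ ≤ C * rate α q₁ q₂ n) ∧
      (∀ φ : StrongDual 𝕜 X₁, ∀ n : ℕ, 1 ≤ n → (1 / q₂ - 1 / 2 < α → 2 ≤ n) →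
        ∃ ξ : ℝ, 1 < ξ ∧ (indexSet α q₁ q₂ σ₁ σ₂ ξ).Finite ∧
          Module.rank 𝕜 (approxSpace a b V (indexSet α q₁ q₂ σ₁ σ₂ ξ)) ≤ (n : Cardinal) ∧
          ‖(∫ y, φ (ι (v y)) ∂prodJacobi a b) -
              φ (smolyakQuad a b ι P (indexSet α q₁ q₂ σ₁ σ₂ ξ) vc)‖ ≤
            C * ‖φ‖ * rate α q₁ q₂ n) := by
  have ha1 : ∀ j, -1 < a j := fun j => by
    obtain ⟨r, hr, h⟩ := ha_lower
    exact hr.trans_le (h j)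
  have hprob : ∀ j, IsProbabilityMeasure (jacobiMeasure (a j) (b j)) := fun j =>
    isProbabilityMeasure_jacobiMeasure (ha1 j) (hab j ▸ ha1 j)
  have hq₂0 : 0 < q₂ := hq₁.trans_le hq₁₂
  have ht0 : 0 ≤ thetaZero a b := by
    have : -1 / 2 ≤ max (max (⨆ j, a j) (⨆ j, b j)) (-1 / 2) := le_max_right _ _
    unfold thetaZero
    linarith
  have ht : 0 ≤ thetaZero a b + ε := by linarith
  have hθe : thetaZero a b + 1 + ε = thetaZero a b + ε + 1 := by ring
  have hlam : 0 ≤ Cε + 1 := by linarith [hCε.1]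
  rw [hθe] at hσ₁ hσ₂
  have hJ := abs_jacobiTensor_le hCε.1.le ht hCε.2
  have hp : ∀ ν ∈ evenIdx, ∑ ν' ∈ evenBelow ν, |tensorIncr a b ν' ν| ≤
      pWeight (thetaZero a b + ε + 1) (Cε + 1) ν := fun ν hν =>
    sum_abs_tensorIncr_le hν hCε.1.le ht hCε.2
  have hs : Summable fun ν : evenIdx =>
      pWeight (thetaZero a b + ε + 1) (Cε + 1) ν * ‖gpcCoeff a b v ν‖ := by
    refine Summable.of_nonneg_of_le (fun ν => mul_nonneg (pWeight_pos hlam _).le (norm_nonneg _))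
      (fun ν => ?_) (hσ₂.summable_mul hlam hq₂0 fun ν => norm_nonneg (gpcCoeff a b v ν))
    refine mul_le_mul_of_nonneg_left ?_ (pWeight_pos hlam _).le
    exact le_mul_of_one_le_left (norm_nonneg _)
      (Real.one_le_rpow (hσ₂.one_lt ν ν.2).le (by linarith))
  obtain ⟨vc, hvc, hvs⟩ := exists_continuous_representative hv hJ hs
  have hint : Integrable v (prodJacobi a b) := hv.1.integrable (by norm_num)
  have hι0 : ∫ y, ι (v y) ∂prodJacobi a b = ι (gpcCoeff a b v 0) :=
    integral_comp_eq_gpcCoeff_zero ι hint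
  have hθ1 : 0 ≤ thetaZero a b + ε + 1 := by linarith
  refine ⟨vc, hvc, ?_⟩
  have hα0 := hP.alpha_pos
  have key : ∃ C > 0, ∀ n : ℕ, (1 ≤ n ∧ (1 / q₂ - 1 / 2 < α → 2 ≤ n)) → ∃ ξ : ℝ,
      (1 < ξ ∧ (indexSet α q₁ q₂ σ₁ σ₂ ξ).Finite ∧
        Module.rank 𝕜 (approxSpace a b V (indexSet α q₁ q₂ σ₁ σ₂ ξ)) ≤ (n : Cardinal)) ∧
      ‖ι (gpcCoeff a b v 0) - smolyakQuad a b ι P (indexSet α q₁ q₂ σ₁ σ₂ ξ) vc‖ ≤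
        C * rate α q₁ q₂ n := by
    refine exists_uniform_const (good := fun ξ n => 1 < ξ ∧ (indexSet α q₁ q₂ σ₁ σ₂ ξ).Finite ∧
        Module.rank 𝕜 (approxSpace a b V (indexSet α q₁ q₂ σ₁ σ₂ ξ)) ≤ (n : Cardinal))
      (err := fun ξ => ‖ι (gpcCoeff a b v 0) -
        smolyakQuad a b ι P (indexSet α q₁ q₂ σ₁ σ₂ ξ) vc‖) (fun n hn => ?_) ?_ ?_
    · have hn0 : (0 : ℝ) < n := by exact_mod_cast hn.1
      unfold rate
      split_ifs with h
      · positivity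
      -- Here `n ≥ 2` is needed: at `n = 1` the factor `(log n)^κ` of the rate would vanish.
      · have : (1 : ℝ) < n := by exact_mod_cast hn.2 (not_le.mp h)
        have := Real.log_pos this
        positivity
    · obtain ⟨ξ, h1, h2⟩ := exists_indexSet_eq_empty hq₁ hq₁₂ hq₂ hσ₁.one_lt hσ₂.one_lt
        hσ₂_mono
      exact ⟨ξ, fun n => ⟨h1, finite_and_rank_approxSpace_le_of_eq_empty a b hP.rank_le h2 n⟩⟩
    · rcases le_or_gt α (1 / q₂ - 1 / 2) with h | h
      · obtain ⟨D, hD, S, hS, hest⟩ := indexSet_estimates_of_le (q₁ := q₁) (σ₁ := σ₁) hP hvs hθ1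
          hlam hp hq₂0 hσ₂ hσ₂_mono h
        refine ⟨S * D ^ α, ?_⟩
        filter_upwards [tendsto_natCast_atTop_atTop.eventually (eventually_gt_atTop D)]
          with n hn _
        have hn0 : (0 : ℝ) < n := hD.trans hn
        have hξ : 1 < (n : ℝ) / D := (one_lt_div hD).mpr hn
        obtain ⟨h1, h2, h3⟩ := hest _ hξ
        refine ⟨n / D, ⟨hξ, h1, h2 n (by rw [mul_div_cancel₀ _ hD.ne'])⟩, h3.trans (le_of_eq ?_)⟩
        rw [rate, if_pos h, Real.div_rpow hn0.le hD.le, Real.rpow_neg hD.le α, div_inv_eq_mul]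
        ring
      · obtain ⟨D, hD, S, hS, hest⟩ := indexSet_estimates_of_lt hP hvs hθ1 hlam hp hq₁ hq₁₂ hq₂
          hσ₁ hσ₂ (hσ₁_mono h) hσ₂_mono h
        set s := 1 / q₁ - 1 / 2 with hs
        set r := 1 / q₂ - 1 / 2 with hr
        have hr0 : 0 < r := by
          have : 1 / 2 < 1 / q₂ := one_div_lt_one_div_of_lt hq₂0 hq₂
          linarith
        have hrs : r ≤ s := by
          have := one_div_le_one_div_of_le hq₁ hq₁₂
          linarith
        have hs0 : 0 < s := by linarith
        have hrα : 0 < 1 - r / α := by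
          have : r / α < 1 := (div_lt_one hα0).mpr h
          linarith
        have hA : 1 ≤ s / α + (1 - r / α) := by
          have : r / α ≤ s / α := div_le_div_of_nonneg_right hrs hα0.le
          linarith
        have hB : 0 ≤ s⁻¹ * (1 - r / α) := by positivity
        -- With `Ξ = ξ (log ξ)^(1/s)` the dimension bound has the form `D ξ^A (log ξ)^B`, where `A =
        -- (α + s - r)/α` and `B = (1 - r/α)/s`. Then `s/A = β` and `B s/A = κ`.
        obtain ⟨C, hC, hev⟩ := eventually_exists_threshold (s := s) hD hA hB
        refine ⟨2 * S * C, ?_⟩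
        filter_upwards [hev] with n hn _
        obtain ⟨ξ, hξe, hξn, hξs⟩ := hn
        have hξ1 : 1 < ξ := by linarith [Real.add_one_lt_exp one_ne_zero]
        have hξ0 : 0 < ξ := by linarith
        have hlog : 1 ≤ Real.log ξ := (Real.le_log_iff_exp_le hξ0).mpr hξe
        have hlog0 : 0 < Real.log ξ := by linarith
        obtain ⟨h1, h2, h3⟩ := hest ξ _ hξ1 rfl
        refine ⟨ξ, ⟨hξ1, h1, h2 n ?_⟩, h3.trans ?_⟩
        · rw [Real.mul_rpow hξ0.le (by positivity), ← Real.rpow_mul hlog0.le, ← mul_assoc (ξ ^ _),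
            ← Real.rpow_add hξ0]
          exact hξn
        -- As `ξ ≥ e`, one has `Ξ ≥ ξ`, so the truncation error in `Ξ` is dominated by the spatial
        -- one.
        · have h4 : (ξ * Real.log ξ ^ s⁻¹) ^ (-s) ≤ ξ ^ (-s) :=
            Real.rpow_le_rpow_of_nonpos hξ0 (le_mul_of_one_le_right hξ0.le
              (Real.one_le_rpow hlog (by positivity))) (by linarith)
          have hA0 : α + (s - r) ≠ 0 := by
            have : 0 < α + (s - r) := by linarith
            exact this.ne'
          have e0 : s / α + (1 - r / α) = (α + (s - r)) / α := by field_simp; ring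
          have e1 : s / (s / α + (1 - r / α)) = s * (α / (α + (1 / q₁ - 1 / q₂))) := by
            rw [e0, show 1 / q₁ - 1 / q₂ = s - r by rw [hs, hr]; ring]
            field_simp
          have e2 : s⁻¹ * (1 - r / α) * s / (s / α + (1 - r / α)) =
              (α + 1 / 2 - 1 / q₂) / (α + 1 / q₁ - 1 / q₂) := by
            rw [e0, show α + 1 / q₁ - 1 / q₂ = α + (s - r) by rw [hs, hr]; ring,
              show α + 1 / 2 - 1 / q₂ = α - r by rw [hr]; ring]
            field_simp
          rw [e1, e2] at hξs
          rw [rate, if_neg (not_le.mpr h), ← hs]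
          calc S * (ξ ^ (-s) + (ξ * Real.log ξ ^ s⁻¹) ^ (-s)) ≤ 2 * S * ξ ^ (-s) := by
                nlinarith
            _ ≤ _ := by
                rw [mul_assoc (2 * S)]
                exact mul_le_mul_of_nonneg_left hξs (by positivity)
  obtain ⟨C, hC, hkey⟩ := key
  refine ⟨C, hC, fun n hn hn' => ?_, fun φ n hn hn' => ?_⟩
  · obtain ⟨ξ, ⟨h1, h2, h3⟩, h4⟩ := hkey n ⟨hn, hn'⟩
    exact ⟨ξ, h1, h2, h3, by rw [hι0]; exact h4⟩
  · obtain ⟨ξ, ⟨h1, h2, h3⟩, h4⟩ := hkey n ⟨hn, hn'⟩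
    refine ⟨ξ, h1, h2, h3, ?_⟩
    have h5 : ∫ y, φ (ι (v y)) ∂prodJacobi a b = φ (ι (gpcCoeff a b v 0)) :=
      integral_comp_eq_gpcCoeff_zero (φ.comp ι) hint
    rw [h5, ← map_sub]
    refine (φ.le_opNorm _).trans ?_
    have := mul_le_mul_of_nonneg_left h4 (norm_nonneg φ)
    linarith
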